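/- **Setting.** Let $K$ be a field. Algorithms are algebraic computation trees over $K$: they may load constants, perform $+,-,\times,/$ on computed elements, and branch on whether a computed element is zero. The cost of a run is its number of arithmetic operations and zero tests. Let $\omega>2$ be a real number such that two $n\times n$ matrices over $K$ can be multiplied with at most $c\,n^{\omega}$ field operations, for some constant $c$ and all $n$. For $A\in K^{m\times n}$, the *rank profile matrix* $\mathcal R_A$ is the unique $m\times n$ matrix with exactly $\operatorname{rank}(A)$ nonzero entries, all equal to one and located on distinct rows and columns, each of whose leading submatrices has the same rank as the corresponding leading submatrix of $A$. For an $n\times n$ matrix $A$, the *left triangular part* $\mathrm{Left}(A)$ keeps the entries $A_{i,j}$ with $i+j\le n$ and replaces the others by $0$, and the *left quasiseparable order* of $A$ is $s=\max_{1\le k\le n-1}\operatorname{rank}(A_{1..k,\,1..n-k})$ (with $s=0$ if $n\le1$). A PLUQ decomposition $A=P\begin{bmatrix}L\\M\end{bmatrix}\begin{bmatrix}U&V\end{bmatrix}Q$ of a matrix of rank $r$ ($P,Q$ permutation matrices, $L$ unit lower triangular and $U$ nonsingular upper triangular, both $r\times r$) *reveals the rank profile matrix* if $\mathcal R_A=P\begin{bmatrix}I_r&0\\0&0\end{bmatrix}Q$.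 **Algorithm LT-RPM** (input: an $n\times n$ matrix $A$). If $n\le 1$, return the zero matrix. Otherwise write $A=\begin{bmatrix}A_1&A_2\\A_3&*\end{bmatrix}$ with $A_3$ of size $\lfloor n/2\rfloor\times\lfloor n/2\rfloor$ and $A_2$ of size $\lceil n/2\rceil\times\lceil n/2\rceil$. Compute a PLUQ decomposition $A_1=P\begin{bmatrix}L\\M\end{bmatrix}\begin{bmatrix}U&V\end{bmatrix}Q$ revealing the rank profile matrix of $A_1$, and let $\mathcal R_1=P\begin{bmatrix}I_r&0\\0&0\end{bmatrix}Q$. Put $\begin{bmatrix}B_1\\B_2\end{bmatrix}=P^TA_2$ and $\begin{bmatrix}C_1&C_2\end{bmatrix}=A_3Q^T$. Compute $D=L^{-1}B_1$ and $E=C_1U^{-1}$ by triangular solving, and $F=B_2-MD$ and $G=C_2-EV$ by matrix multiplication. Let $H=P\begin{bmatrix}0\\F\end{bmatrix}$ and $I=\begin{bmatrix}0&G\end{bmatrix}Q$, compute $\mathcal R_2$ and $\mathcal R_3$ by recursive calls on $H$ and $I$, and return $\begin{bmatrix}\mathcal R_1&\mathcal R_2\\\mathcal R_3&0\end{bmatrix}$.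 **Standard costs.** The subroutines are said to have the standard costs if PLUQ decomposition of an $m\times n$ matrix of rank $r$ takes $O(mn\max(r,1)^{\omega-2})$ field operations, solving an $r\times r$ triangular system with $n$ right-hand sides takes $O(\max(n,r)\,r^{\omega-1})$, and $B-XY$ with $X$ of size $m\times k$ and $Y$ of size $k\times n$ takes $O(\max(m,k)\max(n,k)\max(k,1)^{\omega-2})$. **Theorem.** 1. There exist correct subroutines (PLUQ decomposition revealing the rank profile matrix, the two triangular solvers, and multiplication with update) having the standard costs. 2. With any correct subroutines, LT-RPM returns $\mathrm{Left}(\mathcal R_A)$ for every $n\times n$ matrix $A$; in particular $\mathcal R_A$ exists and is unique. 3. With any correct subroutines having the standard costs, LT-RPM uses $O(n^2\max(s,1)^{\omega-2})$ field operations on every $n\times n$ matrix $A$ of left quasiseparable order $s$. The constant depends only on $K$, $\omega$ and the constant in the costs of the subroutines, and not on $n$, $s$ or $A$. In particular the cost is $O(n^2s^{\omega-2})$ whenever $s\ge1$. -/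

import Mathlib

universe u

namespace LTRPM

/-! ### Field-operation programs

Programs act on an append-only memory holding elements of a field `K`. A program sees field elements
only through their addresses: it can store a constant, store the result of an arithmetic operation
on two stored elements, or branch on whether a stored element is zero. For each fixed input shape
this is an algebraic computation tree. -/

/-- The arithmetic operations of a field. -/
inductive FieldOp
  | add
  | sub
  | mul
  | div

/-- The value of an arithmetic operation (with the convention `x / 0 = 0`). -/
def FieldOp.eval {K : Type u} [Field K] : FieldOp → K → K → K
  | .add, x, y => x + y
  | .sub, x, y => x - y
  | .mul, x, y => x * y
  | .div, x, y => x / y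

/-- The address of a memory cell. -/
abbrev Addr := ℕ

/-- Programs over `K` returning discrete data of type `X` (which may contain addresses). Where a new
cell is written, the rest of the program receives the address of that cell, not its contents. -/
inductive Prog (K : Type u) (X : Type) : Type u
  | ret (x : X) : Prog K X
  | const (c : K) (k : Addr → Prog K X) : Prog K X
  | op (o : FieldOp) (a b : Addr) (k : Addr → Prog K X) : Prog K X
  | isZero (a : Addr) (k : Bool → Prog K X) : Prog K X

/-- Sequential composition of programs. -/
def Prog.bind {K : Type u} {X Y : Type} : Prog K X → (X → Prog K Y) → Prog K Y
  | .ret x, f => f x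
  | .const c k, f => .const c fun a => (k a).bind f
  | .op o a b k, f => .op o a b fun d => (k d).bind f
  | .isZero a k, f => .isZero a fun t => (k t).bind f

instance {K : Type u} : Monad (Prog K) where
  pure := Prog.ret
  bind := Prog.bind

/-- The content of a memory cell. -/
def read {K : Type u} [Field K] (μ : List K) (a : Addr) : K := μ.getD a 0

/-- The outcome of a run: the returned data, the final memory, and the number of field operations
performed. -/
structure Outcome (K : Type u) (X : Type) where
  result : X
  memory : List K
  cost : ℕ

open Classical in
/-- Execution of a program. Each arithmetic operation and each zero test costs one field operation;
loading a constant and handling addresses are free. -/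
noncomputable def Prog.run {K : Type u} [Field K] {X : Type} : Prog K X → List K → Outcome K X
  | .ret x, μ => ⟨x, μ, 0⟩
  | .const c k, μ => (k μ.length).run (μ ++ [c])
  | .op o a b k, μ =>
      let out := (k μ.length).run (μ ++ [o.eval (read μ a) (read μ b)])
      ⟨out.result, out.memory, out.cost + 1⟩
  | .isZero a k, μ =>
      let out := (k (decide (read μ a = 0))).run μ
      ⟨out.result, out.memory, out.cost + 1⟩

/-- An `m × n` matrix stored in memory: its entries are addresses. -/
abbrev AMat (m n : ℕ) := Matrix (Fin m) (Fin n) Addr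

/-- All the entries of the stored matrix refer to allocated memory cells. -/
def AMat.Valid {K : Type u} {m n : ℕ} (A : AMat m n) (μ : List K) : Prop :=
  ∀ i j, A i j < μ.length

/-- The matrix over `K` that a stored matrix represents. -/
def AMat.val {K : Type u} [Field K] {m n : ℕ} (A : AMat m n) (μ : List K) :
    Matrix (Fin m) (Fin n) K :=
  Matrix.of fun i j => read μ (A i j)

/-- `ω` is a feasible exponent of matrix multiplication over `K`: for some constant `C` and all `n`,
two `n × n` matrices over `K` can be multiplied with at most `C * n ^ ω` field operations. -/
def MatMulExponent (K : Type u) [Field K] (ω : ℝ) : Prop :=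
  ∃ (mm : ∀ n : ℕ, AMat n n → AMat n n → Prog K (AMat n n)) (C : ℝ),
    ∀ (n : ℕ) (A B : AMat n n) (μ : List K), A.Valid μ → B.Valid μ →
      ((mm n A B).run μ).result.Valid ((mm n A B).run μ).memory ∧
      ((mm n A B).run μ).result.val ((mm n A B).run μ).memory = A.val μ * B.val μ ∧
      (((mm n A B).run μ).cost : ℝ) ≤ C * (n : ℝ) ^ ω

/-! ### Rank profile matrix, left triangular part, left quasiseparable order -/

/-- The leading `k × l` submatrix (the first `k` rows and the first `l` columns). -/
def leading {K : Type u} {m n : ℕ} (A : Matrix (Fin m) (Fin n) K) (k l : ℕ) :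
    Matrix {i : Fin m // (i : ℕ) < k} {j : Fin n // (j : ℕ) < l} K :=
  A.submatrix Subtype.val Subtype.val

/-- `R` is the rank profile matrix of `A`: it has exactly `rank A` nonzero entries, all equal to one
and located on distinct rows and columns, and each of its leading submatrices has the same rank as
the corresponding leading submatrix of `A`. -/
structure IsRankProfileMatrix {K : Type u} [Field K] {m n : ℕ}
    (A R : Matrix (Fin m) (Fin n) K) : Prop where
  entries : ∀ i j, R i j ≠ 0 → R i j = 1
  rows : ∀ i j j', R i j ≠ 0 → R i j' ≠ 0 → j = j'
  cols : ∀ i i' j, R i j ≠ 0 → R i' j ≠ 0 → i = i'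
  count : {p : Fin m × Fin n | R p.1 p.2 ≠ 0}.ncard = A.rank
  leading_rank : ∀ k l : ℕ, k ≤ m → l ≤ n → (leading R k l).rank = (leading A k l).rank

/-- The left triangular part of an `n × n` matrix: with rows and columns numbered from `1`, the
entries with `i + j ≤ n` are kept and the others are replaced by zero. -/
def leftPart {K : Type u} [Field K] {n : ℕ} (A : Matrix (Fin n) (Fin n) K) :
    Matrix (Fin n) (Fin n) K :=
  Matrix.of fun i j => if ((i : ℕ) + 1) + ((j : ℕ) + 1) ≤ n then A i j else 0

/-- The left quasiseparable order of an `n × n` matrix: the largest rank of a leading `k × (n - k)`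
submatrix, `1 ≤ k ≤ n - 1` (and `0` if there is no such `k`). -/
noncomputable def leftQSOrder {K : Type u} [Field K] {n : ℕ} (A : Matrix (Fin n) (Fin n) K) : ℕ :=
  (Finset.Icc 1 (n - 1)).sup fun k => (leading A k (n - k)).rank

/-! ### PLUQ decompositions -/

/-- The shape of a PLUQ decomposition `P [L; M] [U V] Q` of an `m × n` matrix. The permutation
matrix `P` is given by the bijection sending a row of `[X; Y]`, where `X` has `r` rows, to the row
of `P [X; Y]` in which it is found; `Q` is given likewise by the bijection sending a column of
`[X Y]` to the column of `[X Y] Q` in which it is found. -/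
structure PLUQ (m n : ℕ) (α : Type u) where
  r : ℕ
  P : Fin r ⊕ Fin (m - r) ≃ Fin m
  Q : Fin r ⊕ Fin (n - r) ≃ Fin n
  L : Matrix (Fin r) (Fin r) α
  M : Matrix (Fin (m - r)) (Fin r) α
  U : Matrix (Fin r) (Fin r) α
  V : Matrix (Fin r) (Fin (n - r)) α

/-- The zero-one matrix `P [I 0; 0 0] Q`, where `I` is the identity matrix of size `r`. -/
def PLUQ.pivots {m n : ℕ} {α : Type u} (D : PLUQ m n α) : Matrix (Fin m) (Fin n) ℕ :=
  (Matrix.fromBlocks 1 0 0 0).submatrix D.P.symm D.Q.symm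

/-- All the entries of a stored decomposition refer to allocated memory cells. -/
def PLUQ.Valid {K : Type u} {m n : ℕ} (D : PLUQ m n Addr) (μ : List K) : Prop :=
  AMat.Valid D.L μ ∧ AMat.Valid D.M μ ∧ AMat.Valid D.U μ ∧ AMat.Valid D.V μ

/-- The decomposition over `K` that a stored decomposition represents. -/
def PLUQ.val {K : Type u} [Field K] {m n : ℕ} (D : PLUQ m n Addr) (μ : List K) : PLUQ m n K :=
  ⟨D.r, D.P, D.Q, AMat.val D.L μ, AMat.val D.M μ, AMat.val D.U μ, AMat.val D.V μ⟩

/-- Unit lower triangular matrices. -/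
def IsUnitLower {K : Type u} [Field K] {r : ℕ} (L : Matrix (Fin r) (Fin r) K) : Prop :=
  (∀ i, L i i = 1) ∧ ∀ i j, i < j → L i j = 0

/-- Nonsingular upper triangular matrices. -/
def IsNonsingUpper {K : Type u} [Field K] {r : ℕ} (U : Matrix (Fin r) (Fin r) K) : Prop :=
  (∀ i, U i i ≠ 0) ∧ ∀ i j, j < i → U i j = 0

/-- `D` is a PLUQ decomposition of `A` revealing its rank profile matrix: `A = P [L; M] [U V] Q`
(written here with the permutations moved to the left-hand side) with `L` unit lower triangular and
`U` nonsingular upper triangular, and `P [I 0; 0 0] Q` is the rank profile matrix of `A`. -/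
structure PLUQ.Reveals {K : Type u} [Field K] {m n : ℕ} (D : PLUQ m n K)
    (A : Matrix (Fin m) (Fin n) K) : Prop where
  lower : IsUnitLower D.L
  upper : IsNonsingUpper D.U
  eq : A.submatrix D.P D.Q = Matrix.fromRows D.L D.M * Matrix.fromCols D.U D.V
  rpm : IsRankProfileMatrix A (D.pivots.map (Nat.cast : ℕ → K))

/-! ### Algorithm LT-RPM -/

/-- The subroutines called by LT-RPM: PLUQ decomposition, triangular solving `L⁻¹ B` and `C U⁻¹`,
and multiplication with update `B - X Y`. -/
structure Subroutines (K : Type u) where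
  pluq : ∀ m n : ℕ, AMat m n → Prog K (PLUQ m n Addr)
  solveLower : ∀ r n : ℕ, AMat r r → AMat r n → Prog K (AMat r n)
  solveUpper : ∀ m r : ℕ, AMat m r → AMat r r → Prog K (AMat m r)
  mulSub : ∀ m k n : ℕ, AMat m n → AMat m k → AMat k n → Prog K (AMat m n)

/-- The subroutines meet their specifications. For `pluq`, the decomposition has to reveal the rank
profile matrix. -/
structure Subroutines.Correct {K : Type u} [Field K] (S : Subroutines K) : Prop where
  pluq : ∀ (m n : ℕ) (A : AMat m n) (μ : List K), A.Valid μ →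
    ((S.pluq m n A).run μ).result.Valid ((S.pluq m n A).run μ).memory ∧
    (((S.pluq m n A).run μ).result.val ((S.pluq m n A).run μ).memory).Reveals (A.val μ)
  solveLower : ∀ (r n : ℕ) (L : AMat r r) (B : AMat r n) (μ : List K), L.Valid μ → B.Valid μ →
    IsUnitLower (L.val μ) →
    ((S.solveLower r n L B).run μ).result.Valid ((S.solveLower r n L B).run μ).memory ∧
    ((S.solveLower r n L B).run μ).result.val ((S.solveLower r n L B).run μ).memory
      = (L.val μ)⁻¹ * B.val μ
  solveUpper : ∀ (m r : ℕ) (C : AMat m r) (U : AMat r r) (μ : List K), C.Valid μ → U.Valid μ →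
    IsNonsingUpper (U.val μ) →
    ((S.solveUpper m r C U).run μ).result.Valid ((S.solveUpper m r C U).run μ).memory ∧
    ((S.solveUpper m r C U).run μ).result.val ((S.solveUpper m r C U).run μ).memory
      = C.val μ * (U.val μ)⁻¹
  mulSub : ∀ (m k n : ℕ) (B : AMat m n) (X : AMat m k) (Y : AMat k n) (μ : List K),
    B.Valid μ → X.Valid μ → Y.Valid μ →
    ((S.mulSub m k n B X Y).run μ).result.Valid ((S.mulSub m k n B X Y).run μ).memory ∧
    ((S.mulSub m k n B X Y).run μ).result.val ((S.mulSub m k n B X Y).run μ).memory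
      = B.val μ - X.val μ * Y.val μ

/-- The subroutines run within the usual costs of fast linear algebra with exponent `ω` and constant
`C`: `O(m n r ^ (ω - 2))` for the PLUQ decomposition of an `m × n` matrix of rank `r`,
`O(n r ^ (ω - 1))` for triangular solving with `n ≥ r` right-hand sides of size `r`,
`O(m n k ^ (ω - 2))` for a product of dimensions `m × k` and `k × n` with `k ≤ m` and `k ≤ n` (a
smaller outer dimension is counted as the inner one, and rank or inner dimension zero as one). -/
structure Subroutines.CostBound {K : Type u} [Field K] (S : Subroutines K) (ω C : ℝ) : Prop where
  pluq : ∀ (m n : ℕ) (A : AMat m n) (μ : List K), A.Valid μ →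
    (((S.pluq m n A).run μ).cost : ℝ)
      ≤ C * m * n * ((max (A.val μ).rank 1 : ℕ) : ℝ) ^ (ω - 2)
  solveLower : ∀ (r n : ℕ) (L : AMat r r) (B : AMat r n) (μ : List K), L.Valid μ → B.Valid μ →
    IsUnitLower (L.val μ) →
    (((S.solveLower r n L B).run μ).cost : ℝ) ≤ C * (max n r : ℕ) * (r : ℝ) ^ (ω - 1)
  solveUpper : ∀ (m r : ℕ) (X : AMat m r) (U : AMat r r) (μ : List K), X.Valid μ → U.Valid μ →
    IsNonsingUpper (U.val μ) →
    (((S.solveUpper m r X U).run μ).cost : ℝ) ≤ C * (max m r : ℕ) * (r : ℝ) ^ (ω - 1)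
  mulSub : ∀ (m k n : ℕ) (B : AMat m n) (X : AMat m k) (Y : AMat k n) (μ : List K),
    B.Valid μ → X.Valid μ → Y.Valid μ →
    (((S.mulSub m k n B X Y).run μ).cost : ℝ)
      ≤ C * (max m k : ℕ) * (max n k : ℕ) * ((max k 1 : ℕ) : ℝ) ^ (ω - 2)

/-- Splitting of `n` rows into the first `⌈n / 2⌉` and the last `⌊n / 2⌋`. -/
def splitRows (n : ℕ) : Fin (n - n / 2) ⊕ Fin (n / 2) ≃ Fin n :=
  finSumFinEquiv.trans (finCongr (by omega))

/-- Splitting of `n` columns into the first `⌊n / 2⌋` and the last `⌈n / 2⌉`. -/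
def splitCols (n : ℕ) : Fin (n / 2) ⊕ Fin (n - n / 2) ≃ Fin n :=
  finSumFinEquiv.trans (finCongr (by omega))

/-- Algorithm LT-RPM. -/
def ltRPM {K : Type u} [Field K] (S : Subroutines K) :
    (n : ℕ) → AMat n n → Prog K (Matrix (Fin n) (Fin n) ℕ)
  | 0, _ => pure 0
  | 1, _ => pure 0
  | n + 2, A => do
    let A' := A.submatrix (splitRows (n + 2)) (splitCols (n + 2))
    let A₁ := A'.toBlocks₁₁
    let A₂ := A'.toBlocks₁₂
    let A₃ := A'.toBlocks₂₁
    -- `A₁ = P [L; M] [U V] Q`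
    let D ← S.pluq _ _ A₁
    let R₁ := D.pivots
    -- `[B₁; B₂] = Pᵀ A₂` and `[C₁ C₂] = A₃ Qᵀ`
    let B₁ := (A₂.submatrix D.P id).toRows₁
    let B₂ := (A₂.submatrix D.P id).toRows₂
    let C₁ := (A₃.submatrix id D.Q).toCols₁
    let C₂ := (A₃.submatrix id D.Q).toCols₂
    let X ← S.solveLower _ _ D.L B₁
    let E ← S.solveUpper _ _ C₁ D.U
    let F ← S.mulSub _ _ _ B₂ D.M X
    let G ← S.mulSub _ _ _ C₂ E D.V
    let z ← Prog.const 0 pure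
    -- `H = P [0; F]` and `I = [0 G] Q`
    let H := (Matrix.fromRows (Matrix.of fun _ _ => z) F).submatrix D.P.symm id
    let I := (Matrix.fromCols (Matrix.of fun _ _ => z) G).submatrix id D.Q.symm
    let R₂ ← ltRPM S (n + 2 - (n + 2) / 2) H
    let R₃ ← ltRPM S ((n + 2) / 2) I
    pure ((Matrix.fromBlocks R₁ R₂ R₃ 0).submatrix (splitRows (n + 2)).symm
      (splitCols (n + 2)).symm)
termination_by n => n
decreasing_by all_goals omega

end LTRPM

namespace LTRPM

/-! ### Running programs -/

section Programs

/-! Correctness. An entry of a rank profile matrix is a second difference of ranks of leading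
submatrices (`IsRankProfileMatrix.rank_leading_succ`), so entries of two such matrices agree
whenever the leading ranks differ by terms that cancel in second differences
(`IsRankProfileMatrix.entry_eq`). Write `A₁ = X Y` with `X = P [L; M]` and `Y = [U V] Q`; then `A₂ =
X D + H`, where `H` vanishes in the pivot rows. Since the decomposition reveals the rank profile
matrix, the first `k` rows of `X` have rank equal to the number of pivot rows among them. A vector
of their column space that vanishes in those pivot rows is therefore zero, so this space meets the
column space of the first `k` rows of `H` trivially. Widening a leading submatrix of `k` rows from
`A₁` into `A₂` thus adds exactly a leading rank of `H` (`rank_leading_of_elimination`), and the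
remaining term depends on `k` alone. Transposing gives the same for `A₃` and `I`. Hence the rank
profile matrices of `H` and `I` are the corresponding blocks of that of `A`, up to the antidiagonal.

Cost of LT-RPM. The same rank identities show that `A₁` has rank at most `s` and that `H` and `I`
have order at most `s`. With `s` fixed, each level adds `O(n² s^(ω-2))`, while the squares of the
two half sizes sum to at most `5/8 n²`; the total is geometric.

Subroutines. Products are cut into square blocks of the inner dimension. Triangular systems are
solved by halving, which is geometric because `2 ^ (ω - 1) > 2`. PLUQ comes from a factorization `A
= L U` built by halving the rows, in which every column of `L` and every row of `U` starts at its
pivot (`LU.IsEchelon`). Only pivots inside a leading window contribute to it, and they form a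
product of nonsingular triangular matrices, so leading ranks count pivots (`rank_leading_mul`) and
the pivots are the rank profile matrix. No logarithm appears in the cost because `x ^ (ω-2) + y ^
(ω-2)` is at most a factor below `2` times `(x + y) ^ (ω-2)`. -/

theorem AMat.Valid.mono {K : Type u} {μ ν : List K} {m n : ℕ} {A : AMat m n} (hA : A.Valid μ)
    (h : μ <+: ν) : A.Valid ν := fun i j => (hA i j).trans_le h.length_le

variable {K : Type u} [Field K] {X Y : Type}

theorem Prog.run_bind (p : Prog K X) (f : X → Prog K Y) (μ : List K) :
    (p >>= f).run μ =
      ⟨((f (p.run μ).result).run (p.run μ).memory).result,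
       ((f (p.run μ).result).run (p.run μ).memory).memory,
       (p.run μ).cost + ((f (p.run μ).result).run (p.run μ).memory).cost⟩ := by
  change (p.bind f).run μ = _
  induction p generalizing μ with
  | ret x => simp [Prog.bind, Prog.run]
  | const c k ih => simp [Prog.bind, Prog.run, ih]
  | op o a b k ih => simp [Prog.bind, Prog.run, ih]; omega
  | isZero a k ih => simp [Prog.bind, Prog.run, ih]; omega

theorem Prog.prefix_run (p : Prog K X) (μ : List K) : μ <+: (p.run μ).memory := by
  induction p generalizing μ with
  | ret x => exact List.prefix_rfl
  | const c k ih => exact (List.prefix_append _ _).trans (ih _ _)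
  | op o a b k ih => exact (List.prefix_append _ _).trans (ih _ _)
  | isZero a k ih => exact ih _ _

theorem read_of_prefix {μ ν : List K} (h : μ <+: ν) {a : Addr} (ha : a < μ.length) :
    read ν a = read μ a := by
  obtain ⟨t, rfl⟩ := h
  simp [read, List.getD_eq_getElem?_getD, List.getElem?_append_left ha]

/-- Memory only grows, so a matrix produced by one call keeps its value through all later calls.
This is what allows the outputs of successive subroutines to be combined in one equation. -/
theorem AMat.Valid.val_eq {μ ν : List K} {m n : ℕ} {A : AMat m n} (hA : A.Valid μ)
    (h : μ <+: ν) : A.val ν = A.val μ := by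
  ext i j
  exact read_of_prefix h (hA i j)

/-- The outcome of running `p` on the memory `μ` satisfies `Q`. -/
def Prog.Spec (p : Prog K X) (μ : List K) (Q : X → List K → ℕ → Prop) : Prop :=
  Q (p.run μ).result (p.run μ).memory (p.run μ).cost

/-- The continuation is verified from the postcondition of the first program and the fact that
memory was extended; the cost already spent is passed on inside the postcondition. -/
theorem Prog.Spec.bind {p : Prog K X} {f : X → Prog K Y} {μ : List K}
    {Q₁ : X → List K → ℕ → Prop} {Q : Y → List K → ℕ → Prop} (hp : p.Spec μ Q₁)
    (hf : ∀ x ν c, μ <+: ν → Q₁ x ν c → (f x).Spec ν fun y ξ d => Q y ξ (c + d)) :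
    (p >>= f).Spec μ Q := by
  unfold Prog.Spec
  rw [Prog.run_bind]
  exact hf _ _ _ (p.prefix_run μ) hp

theorem Prog.Spec.pure {x : X} {μ : List K} {Q : X → List K → ℕ → Prop} (h : Q x μ 0) :
    (Pure.pure x : Prog K X).Spec μ Q := h

theorem Prog.Spec.mono {p : Prog K X} {μ : List K} {Q Q' : X → List K → ℕ → Prop}
    (hp : p.Spec μ Q) (h : ∀ x ν c, μ <+: ν → Q x ν c → Q' x ν c) : p.Spec μ Q' :=
  h _ _ _ (p.prefix_run μ) hp

theorem Prog.Spec.const (x : K) (μ : List K) :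
    (Prog.const x Pure.pure : Prog K Addr).Spec μ
      fun a ν c => a < ν.length ∧ read ν a = x ∧ c = 0 := by
  refine ⟨?_, ?_, rfl⟩
  · simp [Prog.run, Pure.pure]
  · simp [Prog.run, Pure.pure, read]

theorem Prog.Spec.op (o : FieldOp) (a b : Addr) (μ : List K) :
    (Prog.op o a b Pure.pure : Prog K Addr).Spec μ
      fun d ν c => d < ν.length ∧ read ν d = o.eval (read μ a) (read μ b) ∧ c = 1 := by
  refine ⟨?_, ?_, rfl⟩
  · simp [Prog.run, Pure.pure]
  · simp [Prog.run, Pure.pure, read]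

/-- Running a family of programs one after the other. -/
def Prog.forFin : (n : ℕ) → (Fin n → Prog K X) → Prog K (Fin n → X)
  | 0, _ => Pure.pure Fin.elim0
  | n + 1, f => do
    let x ← f 0
    let xs ← Prog.forFin n fun i => f i.succ
    Pure.pure (Fin.cons x xs)

/-- Each property must survive memory extension, because it is established at its own iteration and
needed after the last one. -/
theorem Prog.Spec.forFin {n : ℕ} {f : Fin n → Prog K X} {μ : List K} {c : ℝ}
    {Q : Fin n → X → List K → Prop} (hQ : ∀ i x ν ξ, ν <+: ξ → Q i x ν → Q i x ξ)
    (hf : ∀ i ν, μ <+: ν → (f i).Spec ν fun x ξ d => Q i x ξ ∧ (d : ℝ) ≤ c) :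
    (Prog.forFin n f).Spec μ fun xs ξ d => (∀ i, Q i (xs i) ξ) ∧ (d : ℝ) ≤ n * c := by
  induction n generalizing μ with
  | zero => exact ⟨fun i => i.elim0, by simp [Prog.forFin, Pure.pure, Prog.run]⟩
  | succ n ih =>
    refine (hf 0 μ List.prefix_rfl).bind fun x ν d hν hx => ?_
    refine (ih (fun i => hQ i.succ) fun i ξ hξ => hf i.succ ξ (hν.trans hξ)).bind
      fun xs ξ e hξ hxs => ?_
    refine Prog.Spec.pure ⟨?_, ?_⟩
    · intro i
      refine Fin.cases ?_ (fun i => ?_) i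
      · exact hQ _ _ _ _ hξ hx.1
      · exact hxs.1 i
    · push_cast
      linarith [hx.2, hxs.2]

/-- Applying an operation entrywise to two stored matrices. -/
def Prog.entrywise (o : FieldOp) {m n : ℕ} (A B : AMat m n) : Prog K (AMat m n) :=
  Prog.forFin m fun i => Prog.forFin n fun j => Prog.op o (A i j) (B i j) Pure.pure

theorem Prog.Spec.entrywise (o : FieldOp) {m n : ℕ} {A B : AMat m n} {μ : List K}
    (hA : A.Valid μ) (hB : B.Valid μ) :
    (Prog.entrywise o A B).Spec μ fun R ν c =>
      AMat.Valid R ν ∧ AMat.val R ν = Matrix.of (fun i j => o.eval (A.val μ i j) (B.val μ i j)) ∧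
      (c : ℝ) ≤ m * n := by
  have key : ∀ (i : Fin m) (j : Fin n) (ν : List K), μ <+: ν →
      (Prog.op o (A i j) (B i j) Pure.pure : Prog K Addr).Spec ν fun a ξ d =>
        (a < ξ.length ∧ read ξ a = o.eval (A.val μ i j) (B.val μ i j)) ∧ (d : ℝ) ≤ 1 := by
    intro i j ν hν
    refine (Prog.Spec.op o _ _ ν).mono fun a ξ d _ h => ⟨⟨h.1, ?_⟩, by simp [h.2.2]⟩
    rw [h.2.1, read_of_prefix hν (hA i j), read_of_prefix hν (hB i j)]
    rfl
  have mono : ∀ (x : K) (a : Addr) (ν ξ : List K), ν <+: ξ →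
      (a < ν.length ∧ read ν a = x) → (a < ξ.length ∧ read ξ a = x) :=
    fun x a ν ξ h h' => ⟨h'.1.trans_le h.length_le, by rw [read_of_prefix h h'.1, h'.2]⟩
  refine (Prog.Spec.forFin (c := n * 1)
    (Q := fun i (row : Fin n → Addr) ξ => ∀ j, row j < ξ.length ∧
      read ξ (row j) = o.eval (A.val μ i j) (B.val μ i j)) ?_ ?_).mono ?_
  · exact fun i row ν ξ h h' j => mono _ _ _ _ h (h' j)
  · intro i ν hν
    exact Prog.Spec.forFin (Q := fun j a ξ => a < ξ.length ∧
      read ξ a = o.eval (A.val μ i j) (B.val μ i j)) (fun j a ν ξ h h' => mono _ _ _ _ h h')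
      fun j ξ hξ => key i j ξ (hν.trans hξ)
  · rintro R ν c - ⟨h, hc⟩
    refine ⟨fun i j => (h i j).1, ?_, by simpa using hc⟩
    ext i j
    exact (h i j).2

end Programs

/-! ### Multiplication with update -/

section MulSub

/-- The block of size `k × k` at block position `(I, J)` of a stored matrix, padded with `z`. -/
def AMat.padBlock {m n : ℕ} (A : AMat m n) (z : Addr) (k I J : ℕ) : AMat k k :=
  Matrix.of fun a b =>
    if h : I * k + (a : ℕ) < m ∧ J * k + (b : ℕ) < n then A ⟨_, h.1⟩ ⟨_, h.2⟩ else z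

theorem AMat.Valid.padBlock {K : Type u} {m n : ℕ} {A : AMat m n} {μ : List K} (hA : A.Valid μ) {z : Addr}
    (hz : z < μ.length) (k I J : ℕ) : (A.padBlock z k I J).Valid μ := by
  intro a b
  simp only [AMat.padBlock, Matrix.of_apply]
  split_ifs
  exacts [hA _ _, hz]

variable {K : Type u} [Field K]

/-- The product `X Y` of stored matrices computed by square blocks, subtracted from `B`. -/
def mulSubProg (mm : ∀ n : ℕ, AMat n n → AMat n n → Prog K (AMat n n)) (m k n : ℕ)
    (B : AMat m n) (X : AMat m k) (Y : AMat k n) : Prog K (AMat m n) :=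
  if hk : 0 < k then do
    let z ← Prog.const 0 pure
    let T ← Prog.forFin (m / k + 1) fun I => Prog.forFin (n / k + 1) fun J =>
      mm k (X.padBlock z k I 0) (Y.padBlock z k 0 J)
    Prog.entrywise .sub B (Matrix.of fun i j =>
      T ⟨i / k, Nat.lt_succ_of_le (Nat.div_le_div_right i.2.le)⟩
        ⟨j / k, Nat.lt_succ_of_le (Nat.div_le_div_right j.2.le)⟩
        ⟨i % k, Nat.mod_lt _ hk⟩ ⟨j % k, Nat.mod_lt _ hk⟩)
  else pure B

/-- `f` computes `B - X Y` within `O(m n k ^ (ω - 2))` operations. -/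
def MulSubSpec (f : ∀ m k n : ℕ, AMat m n → AMat m k → AMat k n → Prog K (AMat m n))
    (ω C : ℝ) : Prop :=
  ∀ (m k n : ℕ) (B : AMat m n) (X : AMat m k) (Y : AMat k n) (μ : List K),
    B.Valid μ → X.Valid μ → Y.Valid μ → (f m k n B X Y).Spec μ fun R ν c =>
      AMat.Valid R ν ∧ AMat.val R ν = B.val μ - X.val μ * Y.val μ ∧
      (c : ℝ) ≤ C * (max m k : ℕ) * (max n k : ℕ) * (k : ℝ) ^ (ω - 2)

/-- Rounding up to blocks at most doubles each outer dimension, `(m / k + 1) k ≤ 2 max(m, k)`,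
whence the factor `4`. The final subtraction costs `m n`, absorbed by the extra `1` since `k ^ (ω -
2) ≥ 1`. -/
theorem blockMul_cost_le {ω C : ℝ} (hω : 2 < ω) (hC : 0 ≤ C) {m k n : ℕ} (hk : 0 < k) :
    ((m / k + 1 : ℕ) : ℝ) * (((n / k + 1 : ℕ) : ℝ) * (C * (k : ℝ) ^ ω)) + m * n
      ≤ (4 * C + 1) * (max m k : ℕ) * (max n k : ℕ) * (k : ℝ) ^ (ω - 2) := by
  have hk' : (0 : ℝ) < k := by exact_mod_cast hk
  have h1 : (1 : ℝ) ≤ (k : ℝ) ^ (ω - 2) :=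
    Real.one_le_rpow (by exact_mod_cast hk) (by linarith)
  have hpow : (k : ℝ) ^ ω = k * k * (k : ℝ) ^ (ω - 2) := by
    rw [show ω = 2 + (ω - 2) by ring, Real.rpow_add hk']
    norm_num [sq]
  have hdiv : ∀ m : ℕ, ((m / k + 1 : ℕ) : ℝ) * k ≤ 2 * (max m k : ℕ) := by
    intro m
    have : (m / k + 1) * k ≤ 2 * max m k := by
      have := Nat.div_mul_le_self m k
      rw [add_mul]
      omega
    exact_mod_cast this
  have hmn : (m : ℝ) * n ≤ (max m k : ℕ) * (max n k : ℕ) := by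
    exact_mod_cast Nat.mul_le_mul (le_max_left m k) (le_max_left n k)
  set M : ℝ := ((max m k : ℕ) : ℝ)
  set N : ℝ := ((max n k : ℕ) : ℝ)
  set w := (k : ℝ) ^ (ω - 2)
  have hMN : 0 ≤ M * N := by positivity
  have h2 := mul_le_mul (hdiv m) (hdiv n) (by positivity) (by positivity)
  rw [hpow]
  calc _ = (((m / k + 1 : ℕ) : ℝ) * k * (((n / k + 1 : ℕ) : ℝ) * k)) * (C * w) + m * n := by ring
    _ ≤ 2 * M * (2 * N) * (C * w) + M * N * w := by
        refine add_le_add (mul_le_mul_of_nonneg_right h2 (by positivity)) (hmn.trans ?_)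
        exact le_mul_of_one_le_right hMN h1
    _ = _ := by ring

theorem exists_mulSubSpec {ω : ℝ} (hω : 2 < ω) (h : MatMulExponent K ω) :
    ∃ (f : ∀ m k n : ℕ, AMat m n → AMat m k → AMat k n → Prog K (AMat m n)) (C : ℝ),
      0 ≤ C ∧ MulSubSpec f ω C := by
  obtain ⟨mm, C₀, hmm⟩ := h
  set C := max C₀ 0
  have hC : 0 ≤ C := le_max_right _ _
  refine ⟨mulSubProg mm, 4 * C + 1, by positivity, ?_⟩
  intro m k n B X Y μ hB hX hY
  unfold mulSubProg
  split_ifs with hk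
  swap
  -- An empty product is free, which permits the bound `k ^ (ω - 2)` instead of `max k 1 ^ (ω - 2)`.
  -- In the PLUQ recursion a charge for eliminations of rank zero would add up over the levels to a
  -- logarithmic factor.
  · obtain rfl : k = 0 := by omega
    refine Prog.Spec.pure ⟨hB, ?_, ?_⟩
    · ext i j
      simp
    · rw [Nat.cast_zero]
      positivity
  refine (Prog.Spec.const 0 μ).bind fun z ν c hν hz => ?_
  obtain ⟨hz, hz0, rfl⟩ := hz
  have hXν := hX.mono hν
  have hYν := hY.mono hν
  refine (Prog.Spec.forFin (c := ((n / k + 1 : ℕ) : ℝ) * (C * (k : ℝ) ^ ω))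
    (Q := fun I (row : Fin (n / k + 1) → AMat k k) ξ => ∀ J, (row J).Valid ξ ∧
      (row J).val ξ = (X.padBlock z k I 0).val ν * (Y.padBlock z k 0 J).val ν) ?_ ?_).bind ?_
  · intro I row ξ ζ h h' J
    exact ⟨(h' J).1.mono h, by rw [(h' J).1.val_eq h, (h' J).2]⟩
  · intro I ξ hξ
    refine Prog.Spec.forFin (c := C * (k : ℝ) ^ ω)
      (Q := fun J (T : AMat k k) ξ => T.Valid ξ ∧
        T.val ξ = (X.padBlock z k I 0).val ν * (Y.padBlock z k 0 J).val ν) ?_ ?_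
    · intro J T ξ ζ h h'
      exact ⟨h'.1.mono h, by rw [h'.1.val_eq h, h'.2]⟩
    · intro J ζ hζ
      have vX := hXν.padBlock hz k I 0
      have vY := hYν.padBlock hz k 0 J
      have hext := hξ.trans hζ
      obtain ⟨h1, h2, h3⟩ := hmm k _ _ ζ (vX.mono hext) (vY.mono hext)
      refine ⟨⟨h1, ?_⟩, h3.trans (mul_le_mul_of_nonneg_right (le_max_left _ _) (by positivity))⟩
      rw [h2, vX.val_eq hext, vY.val_eq hext]
  · rintro T ξ c hξ ⟨hT, hc⟩
    refine (Prog.Spec.entrywise .sub (hB.mono (hν.trans hξ)) ?_).mono ?_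
    · intro i j
      exact (hT _ _).1 _ _
    · rintro R ζ d - ⟨hR, hval, hd⟩
      refine ⟨hR, ?_, ?_⟩
      · rw [hval]
        ext i j
        have hprod := congrFun (congrFun (hT ⟨i / k, Nat.lt_succ_of_le (Nat.div_le_div_right i.2.le)⟩
          ⟨j / k, Nat.lt_succ_of_le (Nat.div_le_div_right j.2.le)⟩).2
          ⟨i % k, Nat.mod_lt _ hk⟩) ⟨j % k, Nat.mod_lt _ hk⟩
        rw [hB.val_eq (hν.trans hξ), ← hX.val_eq hν, ← hY.val_eq hν]
        simp only [Matrix.of_apply, FieldOp.eval, Matrix.sub_apply]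
        congr 1
        refine Eq.trans hprod ?_
        simp only [Matrix.mul_apply]
        refine Finset.sum_congr rfl fun c _ => ?_
        -- The inner dimension is a single block wide, so each block of the result is one product;
        -- Euclidean division places an entry in its block.
        have hi : (i : ℕ) / k * k + i % k = i := Nat.div_add_mod' _ _
        have hj : (j : ℕ) / k * k + j % k = j := Nat.div_add_mod' _ _
        simp [AMat.val, AMat.padBlock, hi, hj]
      · refine le_trans ?_ (blockMul_cost_le hω hC hk)
        push_cast at hc ⊢
        linarith

end MulSub

/-! ### Triangular solving -/

section Solve

variable {K : Type u} [Field K]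

theorem AMat.val_transpose {m n : ℕ} (A : AMat m n) (μ : List K) :
    AMat.val A.transpose μ = (A.val μ).transpose := rfl

theorem splitCols_inl_val (n : ℕ) (i : Fin (n / 2)) : (splitCols n (Sum.inl i) : ℕ) = i := rfl

theorem splitCols_inr_val (n : ℕ) (i : Fin (n - n / 2)) :
    (splitCols n (Sum.inr i) : ℕ) = n / 2 + i := rfl

theorem IsNonsingUpper.isUnit_det {r : ℕ} {U : Matrix (Fin r) (Fin r) K}
    (hU : IsNonsingUpper U) : IsUnit U.det := by
  rw [Matrix.det_of_isUpperTriangular (fun i j h => hU.2 i j h), isUnit_iff_ne_zero]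
  exact Finset.prod_ne_zero_iff.mpr fun i _ => hU.1 i

theorem IsUnitLower.transpose {r : ℕ} {L : Matrix (Fin r) (Fin r) K} (hL : IsUnitLower L) :
    IsNonsingUpper L.transpose :=
  ⟨fun i => by simp [hL.1 i], fun i j h => hL.2 j i h⟩

/-- Solving `X U = C` for an upper triangular matrix `U` by halving its size. -/
def solveUpperProg
    (f : ∀ m k n : ℕ, AMat m n → AMat m k → AMat k n → Prog K (AMat m n)) (m : ℕ) :
    (r : ℕ) → AMat m r → AMat r r → Prog K (AMat m r)
  | 0, C, _ => pure C
  | 1, C, U => Prog.entrywise .div C (Matrix.of fun _ _ => U 0 0)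
  | r + 2, C, U => do
    let C' := C.submatrix id (splitCols (r + 2))
    let U' := U.submatrix (splitCols (r + 2)) (splitCols (r + 2))
    let X₁ ← solveUpperProg f m ((r + 2) / 2) C'.toCols₁ U'.toBlocks₁₁
    let B ← f _ _ _ C'.toCols₂ X₁ U'.toBlocks₁₂
    let X₂ ← solveUpperProg f m (r + 2 - (r + 2) / 2) B U'.toBlocks₂₂
    pure ((Matrix.fromCols X₁ X₂).submatrix id (splitCols (r + 2)).symm)
termination_by r => r
decreasing_by all_goals omega

/-- The lower left block of `U` is zero, so the first unknown block is determined alone and the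
second after subtracting its contribution. -/
theorem fromCols_mul_upper {m r : ℕ} {C : Matrix (Fin m) (Fin r) K}
    {U : Matrix (Fin r) (Fin r) K} (hU : IsNonsingUpper U)
    {X₁ : Matrix (Fin m) (Fin (r / 2)) K} {X₂ : Matrix (Fin m) (Fin (r - r / 2)) K}
    (h₁ : X₁ * (U.submatrix (splitCols r) (splitCols r)).toBlocks₁₁
      = (C.submatrix id (splitCols r)).toCols₁)
    (h₂ : X₂ * (U.submatrix (splitCols r) (splitCols r)).toBlocks₂₂
      = (C.submatrix id (splitCols r)).toCols₂
        - X₁ * (U.submatrix (splitCols r) (splitCols r)).toBlocks₁₂) :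
    (Matrix.fromCols X₁ X₂).submatrix id (splitCols r).symm * U = C := by
  have h21 : (U.submatrix (splitCols r) (splitCols r)).toBlocks₂₁ = 0 := by
    ext i j
    refine hU.2 _ _ ?_
    rw [Fin.lt_def, splitCols_inl_val, splitCols_inr_val]
    omega
  have hU' : U = (U.submatrix (splitCols r) (splitCols r)).submatrix
      (splitCols r).symm (splitCols r).symm := by
    ext i j; simp
  have hC' : C = (C.submatrix id (splitCols r)).submatrix id (splitCols r).symm := by
    ext i j; simp
  rw [hU', Matrix.submatrix_mul_equiv, ← Matrix.fromBlocks_toBlocks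
    (U.submatrix (splitCols r) (splitCols r)), h21, Matrix.fromCols_mul_fromBlocks, h₁, h₂,
    Matrix.mul_zero, add_zero, add_sub_cancel, Matrix.fromCols_toCols, ← hC']

/-- Bounding the size by `2 ^ κ` and the dimensions by a fixed `N` turns halving into a step from `κ
+ 1` to `κ`, with recurrence `T(κ + 1) ≤ 2 T(κ) + C N B ^ κ` where `B = 2 ^ (ω - 1)`. -/
theorem solveUpperProg_spec
    {f : ∀ m k n : ℕ, AMat m n → AMat m k → AMat k n → Prog K (AMat m n)} {ω C : ℝ}
    (hω : 2 < ω) (hC : 0 ≤ C) (hf : MulSubSpec f ω C) (m r : ℕ) (X : AMat m r) (U : AMat r r)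
    (μ : List K) (hX : X.Valid μ) (hU : U.Valid μ) (hU' : IsNonsingUpper (U.val μ))
    (N κ : ℕ) (hm : m ≤ N) (hr : r ≤ N) (hκ : r ≤ 2 ^ κ) :
    (solveUpperProg f m r X U).Spec μ fun R ν c =>
      AMat.Valid R ν ∧ AMat.val R ν * U.val μ = X.val μ ∧
      (c : ℝ) ≤ (1 + C / (2 ^ (ω - 1) - 2)) * N * ((2 : ℝ) ^ (ω - 1)) ^ κ := by
  have hB : (2 : ℝ) < 2 ^ (ω - 1) := by
    simpa using Real.rpow_lt_rpow_of_exponent_lt (x := 2) (by norm_num)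
      (show (1 : ℝ) < ω - 1 by linarith)
  set B : ℝ := 2 ^ (ω - 1) with hBdef
  have hB0 : 0 < B - 2 := by linarith
  -- The constant `a = 1 + C / (B - 2)` satisfies `2 a + C ≤ a B`, which closes the recurrence; its
  -- summand `1` pays for the divisions of the base case.
  have ha : 1 ≤ 1 + C / (B - 2) := le_add_of_nonneg_right (by positivity)
  have haB : (2 * (1 + C / (B - 2)) + C) ≤ (1 + C / (B - 2)) * B := by
    have : C / (B - 2) * (B - 2) = C := div_mul_cancel₀ _ hB0.ne'
    nlinarith
  set a := 1 + C / (B - 2)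
  induction r using Nat.strong_induction_on generalizing μ κ with
  | _ r ih =>
  match r, ih with
  | 0, _ =>
    rw [solveUpperProg]
    refine Prog.Spec.pure ⟨hX, ?_, ?_⟩
    · ext i j
      exact j.elim0
    · rw [Nat.cast_zero]
      positivity
  | 1, _ =>
    rw [solveUpperProg]
    refine (Prog.Spec.entrywise .div hX fun _ _ => hU 0 0).mono ?_
    rintro R ν c - ⟨hR, hval, hc⟩
    refine ⟨hR, ?_, ?_⟩
    · ext i j
      obtain rfl : j = 0 := Subsingleton.elim _ _
      rw [hval]
      simp only [Matrix.mul_apply, Matrix.of_apply, FieldOp.eval, Fin.sum_univ_one]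
      exact div_mul_cancel₀ _ (hU'.1 0)
    · refine hc.trans ?_
      have h1 : (1 : ℝ) ≤ B ^ κ := one_le_pow₀ (by linarith)
      have h2 : (m : ℝ) ≤ N := by exact_mod_cast hm
      calc (m : ℝ) * (1 : ℕ) ≤ 1 * N * 1 := by simpa using h2
        _ ≤ a * N * B ^ κ := by gcongr
  | r + 2, ih =>
    rw [solveUpperProg]
    obtain ⟨κ, rfl⟩ : ∃ k, κ = k + 1 := by
      rcases κ with _ | k
      · simp at hκ
      · exact ⟨k, rfl⟩
    rw [pow_succ] at hκ
    set e := splitCols (r + 2) with he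
    have hU₁ : IsNonsingUpper ((U.submatrix e e).toBlocks₁₁.map fun a => read μ a) :=
      ⟨fun i => hU'.1 _, fun i j h => hU'.2 _ _ h⟩
    have hU₂ : IsNonsingUpper ((U.submatrix e e).toBlocks₂₂.map fun a => read μ a) := by
      refine ⟨fun i => hU'.1 _, fun i j h => hU'.2 _ _ ?_⟩
      rw [Fin.lt_def, he, splitCols_inr_val, splitCols_inr_val]
      exact Nat.add_lt_add_left h _
    have vU₁₁ : AMat.Valid (U.submatrix e e).toBlocks₁₁ μ := fun i j => hU _ _
    have vU₁₂ : AMat.Valid (U.submatrix e e).toBlocks₁₂ μ := fun i j => hU _ _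
    have vU₂₂ : AMat.Valid (U.submatrix e e).toBlocks₂₂ μ := fun i j => hU _ _
    have vX₁ : AMat.Valid (X.submatrix id e).toCols₁ μ := fun i j => hX _ _
    have vX₂ : AMat.Valid (X.submatrix id e).toCols₂ μ := fun i j => hX _ _
    refine (ih ((r + 2) / 2) (by omega) _ _ μ vX₁ vU₁₁ hU₁ κ (by omega) (by omega)).bind ?_
    rintro X₁ ν c₁ hν ⟨hX₁, hX₁v, hc₁⟩
    refine (hf _ _ _ _ _ _ ν (vX₂.mono hν) hX₁ (vU₁₂.mono hν)).bind ?_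
    rintro Z ξ c₂ hξ ⟨hZ, hZv, hc₂⟩
    have hμξ := hν.trans hξ
    have hU₂' : IsNonsingUpper (AMat.val (U.submatrix e e).toBlocks₂₂ ξ) := by
      rw [vU₂₂.val_eq hμξ]
      exact hU₂
    refine (ih (r + 2 - (r + 2) / 2) (by omega) _ _ ξ hZ (vU₂₂.mono hμξ) hU₂' κ (by omega)
      (by omega)).bind ?_
    rintro X₂ ζ c₃ hζ ⟨hX₂, hX₂v, hc₃⟩
    refine Prog.Spec.pure ⟨?_, ?_, ?_⟩
    · intro i j
      simp only [Matrix.submatrix_apply]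
      rcases e.symm j with k | k
      · exact hX₁.mono (hξ.trans hζ) _ _
      · exact hX₂ _ _
    · have hv : AMat.val ((Matrix.fromCols X₁ X₂).submatrix id e.symm) ζ =
          (Matrix.fromCols (AMat.val X₁ ν) (AMat.val X₂ ζ)).submatrix id e.symm := by
        rw [← hX₁.val_eq (hξ.trans hζ)]
        ext i j
        simp only [AMat.val, Matrix.submatrix_apply, Matrix.of_apply]
        rcases e.symm j with k | k <;> rfl
      rw [hv]
      refine fromCols_mul_upper hU' hX₁v ?_
      rw [vU₂₂.val_eq hμξ, hZv, vX₂.val_eq hν, vU₁₂.val_eq hν] at hX₂v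
      exact hX₂v
    · have hcost : (c₂ : ℝ) ≤ C * N * B ^ κ := by
        refine hc₂.trans ?_
        have hk1 : ((max m ((r + 2) / 2) : ℕ) : ℝ) ≤ N := by
          exact_mod_cast max_le hm (by omega)
        have hk2 : ((max (r + 2 - (r + 2) / 2) ((r + 2) / 2) : ℕ) : ℝ) ≤ (2 : ℝ) ^ κ := by
          exact_mod_cast max_le (by omega) (by omega)
        have hk3 : (((r + 2) / 2 : ℕ) : ℝ) ^ (ω - 2) ≤ ((2 : ℝ) ^ κ) ^ (ω - 2) := by
          refine Real.rpow_le_rpow (by positivity) ?_ (by linarith)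
          exact_mod_cast (by omega : (r + 2) / 2 ≤ 2 ^ κ)
        have hpow : (2 : ℝ) ^ κ * ((2 : ℝ) ^ κ) ^ (ω - 2) = B ^ κ := by
          rw [← Real.rpow_natCast 2 κ, ← Real.rpow_mul (by norm_num),
            ← Real.rpow_add (by norm_num), hBdef, ← Real.rpow_natCast, ← Real.rpow_mul (by norm_num)]
          ring_nf
        calc _ ≤ C * N * (2 : ℝ) ^ κ * ((2 : ℝ) ^ κ) ^ (ω - 2) := by gcongr
          _ = C * N * B ^ κ := by rw [mul_assoc, hpow]
      have hNB : 0 ≤ N * B ^ κ := by positivity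
      push_cast
      calc (c₁ : ℝ) + (c₂ + (c₃ + 0)) ≤ a * N * B ^ κ + (C * N * B ^ κ + a * N * B ^ κ) := by
            linarith
        _ = (2 * a + C) * (N * B ^ κ) := by ring
        _ ≤ a * B * (N * B ^ κ) := by gcongr
        _ = _ := by ring

theorem IsNonsingUpper.eq_mul_inv {m r : ℕ} {U : Matrix (Fin r) (Fin r) K}
    (hU : IsNonsingUpper U) {X C : Matrix (Fin m) (Fin r) K} (h : X * U = C) : X = C * U⁻¹ := by
  rw [← h, Matrix.mul_nonsing_inv_cancel_right _ _ hU.isUnit_det]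

/-- Rounding a size up to a power of two at most doubles it, so bounds in terms of `2 ^ κ` transfer
to the true size at the price of a constant. -/
theorem two_pow_clog_le {r : ℕ} (hr : 0 < r) : 2 ^ Nat.clog 2 r ≤ 2 * r := by
  rcases Nat.lt_or_ge 1 r with h | h
  · have h3 := Nat.pow_pred_clog_lt_self one_lt_two h
    have h4 : 0 < Nat.clog 2 r := Nat.clog_pos one_lt_two h
    obtain ⟨t, ht⟩ := Nat.exists_eq_succ_of_ne_zero h4.ne'
    rw [ht] at h3 ⊢
    rw [pow_succ]
    simp at h3
    omega
  · obtain rfl : r = 1 := by omega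
    simp

/-- `g` computes `X U⁻¹` within `O(m r ^ (ω - 1))` operations. -/
def SolveUpperSpec (g : ∀ m r : ℕ, AMat m r → AMat r r → Prog K (AMat m r)) (ω C : ℝ) : Prop :=
  ∀ (m r : ℕ) (X : AMat m r) (U : AMat r r) (μ : List K), X.Valid μ → U.Valid μ →
    IsNonsingUpper (U.val μ) → (g m r X U).Spec μ fun R ν c =>
      AMat.Valid R ν ∧ AMat.val R ν = X.val μ * (U.val μ)⁻¹ ∧
      (c : ℝ) ≤ C * (max m r : ℕ) * (r : ℝ) ^ (ω - 1)

theorem exists_solveUpperSpec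
    {f : ∀ m k n : ℕ, AMat m n → AMat m k → AMat k n → Prog K (AMat m n)} {ω C : ℝ}
    (hω : 2 < ω) (hC : 0 ≤ C) (hf : MulSubSpec f ω C) :
    ∃ (g : ∀ m r : ℕ, AMat m r → AMat r r → Prog K (AMat m r)) (C' : ℝ),
      0 ≤ C' ∧ SolveUpperSpec g ω C' := by
  have hB : (2 : ℝ) < 2 ^ (ω - 1) := by
    simpa using Real.rpow_lt_rpow_of_exponent_lt (x := 2) (by norm_num)
      (show (1 : ℝ) < ω - 1 by linarith)
  have ha : 0 ≤ 1 + C / ((2 : ℝ) ^ (ω - 1) - 2) :=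
    add_nonneg zero_le_one (div_nonneg hC (by linarith))
  refine ⟨solveUpperProg f, (1 + C / (2 ^ (ω - 1) - 2)) * 2 ^ (ω - 1), by positivity, ?_⟩
  intro m r X U μ hX hU hU'
  rcases Nat.eq_zero_or_pos r with rfl | hr
  · rw [solveUpperProg]
    refine Prog.Spec.pure ⟨hX, ?_, ?_⟩
    · ext i j
      exact j.elim0
    · rw [Nat.cast_zero]
      positivity
  refine (solveUpperProg_spec hω hC hf m r X U μ hX hU hU' (max m r) (Nat.clog 2 r)
    (le_max_left _ _) (le_max_right _ _) (Nat.le_pow_clog one_lt_two r)).mono ?_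
  rintro R ν c - ⟨hR, hv, hc⟩
  refine ⟨hR, hU'.eq_mul_inv hv, hc.trans ?_⟩
  have h2 := two_pow_clog_le hr
  have h3 : ((2 : ℝ) ^ (ω - 1)) ^ Nat.clog 2 r ≤ 2 ^ (ω - 1) * (r : ℝ) ^ (ω - 1) := by
    rw [← Real.mul_rpow (by norm_num) (by positivity), ← Real.rpow_natCast, ← Real.rpow_mul
      (by norm_num), mul_comm (ω - 1), Real.rpow_mul (by norm_num), Real.rpow_natCast]
    refine Real.rpow_le_rpow (by positivity) ?_ (by linarith)
    exact_mod_cast h2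
  calc _ ≤ (1 + C / ((2 : ℝ) ^ (ω - 1) - 2)) * ((max m r : ℕ) : ℝ) *
        (2 ^ (ω - 1) * (r : ℝ) ^ (ω - 1)) := by gcongr
    _ = _ := by ring

end Solve

/-! ### Ranks of leading submatrices -/

section Rank

variable {K : Type u} [Field K]

theorem rank_leading_transpose {m n : ℕ} (A : Matrix (Fin m) (Fin n) K) (k l : ℕ) :
    (leading A.transpose k l).rank = (leading A l k).rank :=
  Matrix.rank_transpose (leading A l k)

theorem rank_leading_self {m n : ℕ} (A : Matrix (Fin m) (Fin n) K) :
    (leading A m n).rank = A.rank :=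
  Matrix.rank_submatrix A (Equiv.subtypeUnivEquiv fun i : Fin m => i.2)
    (Equiv.subtypeUnivEquiv fun j : Fin n => j.2)

theorem rank_leading_width {m n : ℕ} (A : Matrix (Fin m) (Fin n) K) (k : ℕ) :
    (leading A k n).rank
      = (A.submatrix (Subtype.val : {i : Fin m // (i : ℕ) < k} → Fin m) id).rank :=
  Matrix.rank_submatrix (A.submatrix (Subtype.val : {i : Fin m // (i : ℕ) < k} → Fin m) id)
    (Equiv.refl _) (Equiv.subtypeUnivEquiv fun j : Fin n => j.2)

theorem rank_leading_zero {m n : ℕ} (A : Matrix (Fin m) (Fin n) K) (k : ℕ) :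
    (leading A k 0).rank = 0 := by
  have h := Matrix.rank_le_card_width (leading A k 0)
  simpa using h

/-- The rank of a leading submatrix of a product whose factors have leading entries at the positions
given by `p` and `q`. -/
theorem rank_leading_mul {m n : ℕ} {ι : Type*} [Fintype ι] [LinearOrder ι]
    {X : Matrix (Fin m) ι K} {Y : Matrix ι (Fin n) K} {p : ι → Fin m} {q : ι → Fin n}
    (hX : ∀ k i, i < p k → X i k = 0) (hXp : ∀ k, X (p k) k ≠ 0)
    (hXl : ∀ k l, k < l → X (p k) l = 0) (hY : ∀ k j, j < q k → Y k j = 0)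
    (hYq : ∀ k, Y k (q k) ≠ 0) (hYu : ∀ k l, l < k → Y k (q l) = 0) (a b : ℕ) :
    (leading (X * Y) a b).rank = Fintype.card {k // (p k : ℕ) < a ∧ (q k : ℕ) < b} := by
  -- A term of the sum whose pivot lies outside the window vanishes there: its column of `X` starts
  -- at row `p k` or below it, or its row of `Y` starts at `q k` or to the right of it.
  have hmul : ∀ (i : Fin m) (j : Fin n), (i : ℕ) < a → (j : ℕ) < b → (X * Y) i j =
      ∑ k : {k // (p k : ℕ) < a ∧ (q k : ℕ) < b}, X i k * Y k j := by
    intro i j hi hj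
    rw [Matrix.mul_apply, ← Finset.sum_subtype {k | (p k : ℕ) < a ∧ (q k : ℕ) < b}
      (fun k => Finset.mem_filter_univ k) fun k => X i k * Y k j]
    refine (Finset.sum_filter_of_ne fun k _ hk => ?_).symm
    constructor
    · by_contra h
      exact hk (by rw [hX k i (Fin.lt_def.2 (by omega)), zero_mul])
    · by_contra h
      exact hk (by rw [hY k j (Fin.lt_def.2 (by omega)), mul_zero])
  set ι' := {k // (p k : ℕ) < a ∧ (q k : ℕ) < b}
  -- The rows and columns of the surviving pivots cut out a product of two nonsingular triangular
  -- matrices. This gives the lower bound; the inner dimension gives the upper bound.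
  let X' : Matrix ι' ι' K := X.submatrix (fun k => p k) Subtype.val
  let Y' : Matrix ι' ι' K := Y.submatrix Subtype.val fun k => q k
  have hX' : X'.det ≠ 0 := by
    rw [Matrix.det_of_isLowerTriangular X' fun i j h => hXl _ _ h]
    exact Finset.prod_ne_zero_iff.mpr fun k _ => hXp k
  have hY' : Y'.det ≠ 0 := by
    rw [Matrix.det_of_isUpperTriangular (M := Y') fun i j h => hYu _ _ h]
    exact Finset.prod_ne_zero_iff.mpr fun k _ => hYq k
  apply le_antisymm
  · have : leading (X * Y) a b =
        (X.submatrix Subtype.val Subtype.val : Matrix _ ι' K) *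
        (Y.submatrix Subtype.val Subtype.val : Matrix ι' _ K) := by
      ext i j
      exact hmul _ _ i.2 j.2
    rw [this]
    exact (Matrix.rank_mul_le_left _ _).trans (Matrix.rank_le_card_width _)
  · have : (leading (X * Y) a b).submatrix (fun k : ι' => ⟨p k, k.2.1⟩)
        (fun k : ι' => ⟨q k, k.2.2⟩) = X' * Y' := by
      ext i j
      exact hmul _ _ i.2.1 j.2.2
    refine le_trans (le_of_eq ?_) (Matrix.rank_submatrix_le _
      (fun k : ι' => ⟨p k, k.2.1⟩) (fun k : ι' => ⟨q k, k.2.2⟩))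
    rw [this, Matrix.rank_of_det_ne_zero]
    rw [Matrix.det_mul]
    exact mul_ne_zero hX' hY'

/-- The rank of a leading submatrix of a partial permutation matrix. -/
theorem rank_leading_perm {m n : ℕ} {ι : Type*} [Fintype ι] {R : Matrix (Fin m) (Fin n) K}
    {p : ι → Fin m} {q : ι → Fin n} (hp : p.Injective) (hq : q.Injective)
    (h₁ : ∀ k, R (p k) (q k) = 1) (h₀ : ∀ i j, (∀ k, p k = i → q k ≠ j) → R i j = 0) (a b : ℕ) :
    (leading R a b).rank = Fintype.card {k // (p k : ℕ) < a ∧ (q k : ℕ) < b} := by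
  -- Any order on the index set makes the two zero-one factors below triangular on the pivots, since
  -- `p` and `q` are injective; the one pulled back along `p` will do.
  let _ : LinearOrder ι := LinearOrder.lift' p hp
  have hR : R = (Matrix.of fun i k => if p k = i then (1 : K) else 0) *
      (Matrix.of fun k j => if q k = j then (1 : K) else 0) := by
    ext i j
    simp only [Matrix.mul_apply, Matrix.of_apply]
    by_cases h : ∃ k, p k = i ∧ q k = j
    · obtain ⟨k, rfl, rfl⟩ := h
      rw [h₁, Finset.sum_eq_single k]
      · simp
      · intro l _ hl
        rw [if_neg (hp.ne hl), zero_mul]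
      · simp
    · push Not at h
      rw [h₀ i j h]
      refine (Finset.sum_eq_zero fun k _ => ?_).symm
      by_cases hk : p k = i
      · rw [if_neg (h k hk), mul_zero]
      · rw [if_neg hk, zero_mul]
  rw [hR]
  refine rank_leading_mul (fun k i h => ?_) (fun k => ?_) (fun k l h => ?_) (fun k i h => ?_)
    (fun k => ?_) (fun k l h => ?_) a b
  · simp [h.ne']
  · simp
  · simp [hp.eq_iff, h.ne']
  · simp [h.ne']
  · simp
  · simp [hq.eq_iff, h.ne']

end Rank

/-! ### Uniqueness of the rank profile matrix -/

section RankProfile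

variable {K : Type u} [Field K] {m n : ℕ} {A R : Matrix (Fin m) (Fin n) K}

open Classical in
theorem IsRankProfileMatrix.rank_leading_eq_card (h : IsRankProfileMatrix A R) (a b : ℕ) :
    (leading R a b).rank = (Finset.univ.filter fun x : Fin m × Fin n =>
      R x.1 x.2 ≠ 0 ∧ (x.1 : ℕ) < a ∧ (x.2 : ℕ) < b).card := by
  rw [rank_leading_perm (ι := {x : Fin m × Fin n // R x.1 x.2 ≠ 0}) (p := fun k => k.1.1)
    (q := fun k => k.1.2), ← Fintype.card_coe]
  · refine Fintype.card_congr ((Equiv.subtypeSubtypeEquivSubtypeInter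
      (fun x : Fin m × Fin n => R x.1 x.2 ≠ 0) (fun x => (x.1 : ℕ) < a ∧ (x.2 : ℕ) < b)).trans
      (Equiv.subtypeEquivRight fun x => by simp))
  · rintro ⟨⟨i, j⟩, h1⟩ ⟨⟨i', j'⟩, h2⟩ (rfl : i = i')
    obtain rfl := h.rows _ _ _ h1 h2
    rfl
  · rintro ⟨⟨i, j⟩, h1⟩ ⟨⟨i', j'⟩, h2⟩ (rfl : j = j')
    obtain rfl := h.cols _ _ _ h1 h2
    rfl
  · exact fun k => h.entries _ _ k.2
  · intro i j hij
    by_contra h0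
    exact hij ⟨(i, j), h0⟩ rfl rfl

open Classical in
/-- The entries of the rank profile matrix are second differences of ranks of leading
submatrices. -/
theorem IsRankProfileMatrix.rank_leading_succ (h : IsRankProfileMatrix A R) (i : Fin m)
    (j : Fin n) : (leading A (i + 1) (j + 1)).rank + (leading A i j).rank =
      (leading A (i + 1) j).rank + (leading A i (j + 1)).rank + if R i j ≠ 0 then 1 else 0 := by
  have hi := i.2
  have hj := j.2
  rw [← h.leading_rank _ _ hi hj, ← h.leading_rank _ _ hi.le hj.le, ← h.leading_rank _ _ hi hj.le,
    ← h.leading_rank _ _ hi.le hj]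
  simp only [h.rank_leading_eq_card, Finset.card_filter]
  have : (if R i j ≠ 0 then 1 else 0) =
      ∑ x : Fin m × Fin n, if x = (i, j) then (if R x.1 x.2 ≠ 0 then 1 else 0) else 0 := by
    rw [Finset.sum_ite_eq' Finset.univ (i, j)]
    simp
  rw [this, ← Finset.sum_add_distrib, ← Finset.sum_add_distrib, ← Finset.sum_add_distrib]
  refine Finset.sum_congr rfl fun x _ => ?_
  by_cases h0 : R x.1 x.2 ≠ 0
  · simp only [Prod.ext_iff, Fin.ext_iff, h0, true_and, ne_eq, not_false_eq_true, if_true]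
    split_ifs <;> omega
  · simp [h0]

/-- The corrections `c₁, …, c₄` cancel in the second difference, which determines the entry. In the
block steps they depend on only one of the two indices, so they are equal in pairs. -/
theorem IsRankProfileMatrix.entry_eq (h : IsRankProfileMatrix A R) {m' n' : ℕ}
    {A' R' : Matrix (Fin m') (Fin n') K} (h' : IsRankProfileMatrix A' R') {i : Fin m} {j : Fin n}
    {i' : Fin m'} {j' : Fin n'} {c₁ c₂ c₃ c₄ : ℕ}
    (hc : c₁ + c₂ = c₃ + c₄)
    (h₁ : (leading A (i + 1) (j + 1)).rank = c₁ + (leading A' (i' + 1) (j' + 1)).rank)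
    (h₂ : (leading A i j).rank = c₂ + (leading A' i' j').rank)
    (h₃ : (leading A (i + 1) j).rank = c₃ + (leading A' (i' + 1) j').rank)
    (h₄ : (leading A i (j + 1)).rank = c₄ + (leading A' i' (j' + 1)).rank) :
    R i j = R' i' j' := by
  classical
  have e := h.rank_leading_succ i j
  have e' := h'.rank_leading_succ i' j'
  by_cases hR : R i j = 0 <;> by_cases hR' : R' i' j' = 0
  · rw [hR, hR']
  · simp only [hR, hR', ne_eq, not_true_eq_false, not_false_eq_true, if_true, if_false] at e e'
    omega
  · simp only [hR, hR', ne_eq, not_true_eq_false, not_false_eq_true, if_true, if_false] at e e'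
    omega
  · rw [h.entries _ _ hR, h'.entries _ _ hR']

theorem IsRankProfileMatrix.unique {R' : Matrix (Fin m) (Fin n) K} (h : IsRankProfileMatrix A R)
    (h' : IsRankProfileMatrix A R') : R = R' := by
  ext i j
  exact h.entry_eq h' rfl (zero_add _).symm (zero_add _).symm (zero_add _).symm (zero_add _).symm

/-- A zero-one matrix with distinct rows and columns and the same leading ranks as `A` is the rank
profile matrix of `A`. -/
theorem isRankProfileMatrix_of_rank_leading {r : ℕ} {p : Fin r → Fin m} {q : Fin r → Fin n}
    (hp : p.Injective) (hq : q.Injective) (h₁ : ∀ k, R (p k) (q k) = 1)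
    (h₀ : ∀ i j, (∀ k, p k = i → q k ≠ j) → R i j = 0)
    (hA : ∀ a b : ℕ, (leading A a b).rank =
      Fintype.card {k // (p k : ℕ) < a ∧ (q k : ℕ) < b}) : IsRankProfileMatrix A R := by
  have hne : ∀ i j, R i j ≠ 0 → ∃ k, p k = i ∧ q k = j := by
    intro i j h
    by_contra! h'
    exact h (h₀ i j h')
  refine ⟨?_, ?_, ?_, ?_, ?_⟩
  · intro i j h
    obtain ⟨k, rfl, rfl⟩ := hne i j h
    exact h₁ k
  · intro i j j' h h'
    obtain ⟨k, rfl, rfl⟩ := hne i j h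
    obtain ⟨l, hl, rfl⟩ := hne _ j' h'
    rw [hp hl]
  · intro i i' j h h'
    obtain ⟨k, rfl, rfl⟩ := hne i j h
    obtain ⟨l, rfl, hl⟩ := hne i' _ h'
    rw [hq hl]
  · have hset : {x : Fin m × Fin n | R x.1 x.2 ≠ 0} = Set.range fun k => (p k, q k) := by
      ext ⟨i, j⟩
      constructor
      · intro h
        obtain ⟨k, rfl, rfl⟩ := hne i j h
        exact ⟨k, rfl⟩
      · rintro ⟨k, hk⟩
        cases hk
        change R (p k) (q k) ≠ 0
        rw [h₁]
        exact one_ne_zero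
    rw [hset, ← Set.image_univ, Set.ncard_image_of_injective _ fun k l h => hp (Prod.ext_iff.1 h).1,
      Set.ncard_univ, Nat.card_fin, ← rank_leading_self, hA]
    simp
  · intro a b _ _
    rw [hA, rank_leading_perm hp hq h₁ h₀]

end RankProfile

/-! ### Echelon factorizations -/

section LU

theorem finSumFinEquiv_lt_iff {a b : ℕ} {s t : Fin a ⊕ Fin b} :
    finSumFinEquiv s < finSumFinEquiv t ↔ Sum.Lex (· < ·) (· < ·) s t := by
  rcases s with s | s <;> rcases t with t | t <;>
    rw [Fin.lt_def]
  · exact ⟨fun h => Sum.Lex.inl (Fin.lt_def.2 h), fun h => by cases h with | inl h => exact h⟩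
  · exact iff_of_true (s.2.trans_le (Nat.le_add_right _ _)) (Sum.Lex.sep _ _)
  · exact iff_of_false (t.2.trans_le (Nat.le_add_right _ _)).not_gt Sum.lex_inr_inl
  · exact ⟨fun h => Sum.Lex.inr (Fin.lt_def.2 (Nat.add_lt_add_iff_left.1 h)),
      fun h => by cases h with | inr h => exact Nat.add_lt_add_left h _⟩

/-- The shape of a factorization `A = L U` of an `m × n` matrix through `r` pivots, the `k`-th of
which lies at position `(p k, q k)`. -/
structure LU (m n : ℕ) (α : Type u) where
  r : ℕ
  p : Fin r → Fin m
  q : Fin r → Fin n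
  L : Matrix (Fin m) (Fin r) α
  U : Matrix (Fin r) (Fin n) α

/-- All the entries of a stored factorization refer to allocated memory cells. -/
def LU.Valid {K : Type u} {m n : ℕ} (D : LU m n Addr) (μ : List K) : Prop :=
  (∀ i k, D.L i k < μ.length) ∧ ∀ k j, D.U k j < μ.length

theorem LU.Valid.mono {K : Type u} {m n : ℕ} {D : LU m n Addr} {μ ν : List K} (h : D.Valid μ)
    (hν : μ <+: ν) : D.Valid ν :=
  ⟨fun i k => (h.1 i k).trans_le hν.length_le, fun k j => (h.2 k j).trans_le hν.length_le⟩

/-- The factorization without pivots. -/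
def LU.empty (m n : ℕ) (α : Type u) : LU m n α :=
  ⟨0, Fin.elim0, Fin.elim0, Matrix.of fun _ k => k.elim0, Matrix.of fun k _ => k.elim0⟩

/-- The factorization of a single row with a pivot at `j`. -/
def LU.row {n : ℕ} {α : Type u} (one : α) (v : Fin n → α) (j : Fin n) : LU 1 n α :=
  ⟨1, fun _ => 0, fun _ => j, Matrix.of fun _ _ => one, Matrix.of fun _ => v⟩

/-- The factorization `[L₁ 0; E L₂] [U₁; U₂]` obtained from factorizations of the upper half of the
rows and of the lower half after elimination. -/
def LU.combine {m n : ℕ} {α : Type u} (zero : α) (D₁ : LU (m / 2) n α) (D₂ : LU (m - m / 2) n α)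
    (E : Matrix (Fin (m - m / 2)) (Fin D₁.r) α) : LU m n α where
  r := D₁.r + D₂.r
  p k := splitCols m (Sum.map D₁.p D₂.p (finSumFinEquiv.symm k))
  q k := Sum.elim D₁.q D₂.q (finSumFinEquiv.symm k)
  L := (Matrix.fromBlocks D₁.L (Matrix.of fun _ _ => zero) E D₂.L).submatrix (splitCols m).symm
    finSumFinEquiv.symm
  U := (Matrix.fromRows D₁.U D₂.U).submatrix finSumFinEquiv.symm id

theorem LU.Valid.combine {K : Type u} {m n : ℕ} {z : Addr} {D₁ : LU (m / 2) n Addr}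
    {D₂ : LU (m - m / 2) n Addr} {E : AMat (m - m / 2) D₁.r} {μ : List K} (hz : z < μ.length)
    (h₁ : D₁.Valid μ) (h₂ : D₂.Valid μ) (hE : E.Valid μ) : (LU.combine z D₁ D₂ E).Valid μ := by
  constructor
  · intro i k
    obtain ⟨k, rfl⟩ := finSumFinEquiv.surjective k
    obtain ⟨i, rfl⟩ := (splitCols m).surjective i
    simp only [LU.combine, Matrix.submatrix_apply, Equiv.symm_apply_apply]
    rcases i with i | i <;> rcases k with k | k
    exacts [h₁.1 _ _, hz, hE _ _, h₂.1 _ _]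
  · intro k j
    obtain ⟨k, rfl⟩ := finSumFinEquiv.surjective k
    simp only [LU.combine, Matrix.submatrix_apply, Equiv.symm_apply_apply]
    rcases k with k | k
    exacts [h₁.2 _ _, h₂.2 _ _]

variable {K : Type u} [Field K]

/-- The factorization over `K` that a stored factorization represents. -/
def LU.val {m n : ℕ} (D : LU m n Addr) (μ : List K) : LU m n K :=
  ⟨D.r, D.p, D.q, Matrix.of fun i k => read μ (D.L i k), Matrix.of fun k j => read μ (D.U k j)⟩

theorem LU.Valid.val_eq {m n : ℕ} {D : LU m n Addr} {μ ν : List K} (h : D.Valid μ)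
    (hν : μ <+: ν) : D.val ν = D.val μ := by
  unfold LU.val
  congr 1
  · ext i k
    exact read_of_prefix hν (h.1 i k)
  · ext k j
    exact read_of_prefix hν (h.2 k j)

theorem LU.val_empty (m n : ℕ) (μ : List K) : (LU.empty m n Addr).val μ = LU.empty m n K := by
  unfold LU.val LU.empty
  congr 1
  · ext _ k
    exact k.elim0
  · ext k
    exact k.elim0

theorem LU.val_combine {m n : ℕ} (z : Addr) (D₁ : LU (m / 2) n Addr) (D₂ : LU (m - m / 2) n Addr)
    (E : AMat (m - m / 2) D₁.r) (μ : List K) :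
    (LU.combine z D₁ D₂ E).val μ = LU.combine (read μ z) (D₁.val μ) (D₂.val μ) (E.val μ) := by
  unfold LU.val LU.combine
  congr 1
  · ext i k
    simp only [Matrix.of_apply, Matrix.submatrix_apply]
    rcases (splitCols m).symm i with i | i <;> rcases finSumFinEquiv.symm k with k | k <;> rfl
  · ext k j
    simp only [Matrix.of_apply, Matrix.submatrix_apply]
    rcases finSumFinEquiv.symm k with k | k <;> rfl

/-- `D` is a factorization of `A` in which the `k`-th column of `L` has its leading entry `1` in row
`p k`, the `k`-th row of `U` has its leading entry in column `q k`, and the pivot columns of `U` form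
an upper triangular matrix. -/
structure LU.IsEchelon {m n : ℕ} (D : LU m n K) (A : Matrix (Fin m) (Fin n) K) : Prop where
  eq : A = D.L * D.U
  p_mono : StrictMono D.p
  L_pivot : ∀ k, D.L (D.p k) k = 1
  L_zero : ∀ k i, i < D.p k → D.L i k = 0
  U_pivot : ∀ k, D.U k (D.q k) ≠ 0
  U_zero : ∀ k j, j < D.q k → D.U k j = 0
  U_upper : ∀ k l, l < k → D.U k (D.q l) = 0

namespace LU.IsEchelon

variable {m n : ℕ} {D : LU m n K} {A : Matrix (Fin m) (Fin n) K}

theorem q_injective (h : D.IsEchelon A) : D.q.Injective := by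
  intro k l hkl
  rcases lt_trichotomy k l with hlt | rfl | hlt
  · exact absurd (hkl ▸ h.U_upper l k hlt) (h.U_pivot l)
  · rfl
  · exact absurd (hkl ▸ h.U_upper k l hlt) (h.U_pivot k)

theorem r_le_height (h : D.IsEchelon A) : D.r ≤ m := by
  simpa using Fintype.card_le_of_injective _ h.p_mono.injective

theorem r_le_width (h : D.IsEchelon A) : D.r ≤ n := by
  simpa using Fintype.card_le_of_injective _ h.q_injective

theorem isUnitLower (h : D.IsEchelon A) : IsUnitLower (D.L.submatrix D.p id) :=
  ⟨h.L_pivot, fun _ l hkl => h.L_zero l _ (h.p_mono hkl)⟩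

theorem isNonsingUpper (h : D.IsEchelon A) : IsNonsingUpper (D.U.submatrix id D.q) :=
  ⟨h.U_pivot, h.U_upper⟩

/-- The echelon conditions are those of `rank_leading_mul`; monotonicity of `p` makes the pivot rows
of `L` lower triangular. The pivot positions therefore carry the rank profile. -/
theorem rank_leading (h : D.IsEchelon A) (a b : ℕ) :
    (leading A a b).rank = Fintype.card {k // (D.p k : ℕ) < a ∧ (D.q k : ℕ) < b} := by
  rw [h.eq]
  exact rank_leading_mul h.L_zero (fun k => by rw [h.L_pivot]; exact one_ne_zero)
    (fun k l hkl => h.L_zero l _ (h.p_mono hkl)) h.U_zero h.U_pivot h.U_upper a b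

theorem rank_eq (h : D.IsEchelon A) : A.rank = D.r := by
  rw [← rank_leading_self, h.rank_leading]
  simp

theorem empty_zero : (LU.empty m n K).IsEchelon 0 :=
  ⟨by ext i j; exact (Finset.sum_empty (f := fun _ : Fin 0 => (0 : K))).symm, fun k => k.elim0, fun k => k.elim0, fun k => k.elim0,
    fun k => k.elim0, fun k => k.elim0, fun k => k.elim0⟩

theorem row {v : Fin n → K} {j : Fin n} (hj : v j ≠ 0) (h0 : ∀ i < j, v i = 0) :
    (LU.row 1 v j).IsEchelon (Matrix.of fun _ => v) := by
  have hlt : ∀ k l : Fin 1, ¬k < l := fun k l h => by omega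
  refine ⟨?_, fun k l h => absurd h (hlt k l), fun _ => rfl, fun _ i h => absurd h (hlt i 0),
    fun _ => hj, fun _ => h0, fun k l h => absurd h (hlt l k)⟩
  ext i j
  exact ((Fin.sum_univ_one fun k : Fin 1 => 1 * v j).trans (one_mul _)).symm

/-- Eliminating the lower rows by `E` clears them in the pivot columns of `D₁`, so the second
factorization has no pivot there and the stacked factors remain echelon. The pivot rows stay
increasing because the upper half precedes the lower half. -/
theorem combine {D₁ : LU (m / 2) n K} {D₂ : LU (m - m / 2) n K}
    {E : Matrix (Fin (m - m / 2)) (Fin D₁.r) K}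
    (h₁ : D₁.IsEchelon (A.submatrix (splitCols m) id).toRows₁)
    (hE : E * D₁.U.submatrix id D₁.q = (A.submatrix (splitCols m) id).toRows₂.submatrix id D₁.q)
    (h₂ : D₂.IsEchelon ((A.submatrix (splitCols m) id).toRows₂ - E * D₁.U)) :
    (LU.combine 0 D₁ D₂ E).IsEchelon A := by
  -- The residual vanishes in the pivot columns of `D₁`, and the pivot rows of `D₂.L` form an
  -- invertible matrix that can be cancelled. This is the only mixed condition in the triangularity
  -- of the combined `U`.
  have hU₂ : D₂.U.submatrix id D₁.q = 0 := by
    have h0 : D₂.L.submatrix D₂.p id * D₂.U.submatrix id D₁.q = 0 := by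
      have : ((A.submatrix (splitCols m) id).toRows₂ - E * D₁.U).submatrix D₂.p D₁.q
          = 0 := by
        ext i j
        have := congrFun (congrFun hE (D₂.p i)) j
        simp only [Matrix.submatrix_apply, Matrix.sub_apply, Matrix.zero_apply]
        rw [sub_eq_zero]
        exact this.symm
      rw [h₂.eq] at this
      exact this
    have hunit : IsUnit (D₂.L.submatrix D₂.p id).det := by
      rw [← Matrix.det_transpose]
      exact h₂.isUnitLower.transpose.isUnit_det
    rw [← Matrix.nonsing_inv_mul_cancel_left _ (D₂.U.submatrix id D₁.q) hunit, h0, Matrix.mul_zero]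
  refine ⟨?_, ?_, ?_, ?_, ?_, ?_, ?_⟩
  · have : A = (A.submatrix (splitCols m) id).submatrix (splitCols m).symm id := by
      ext i j; simp
    rw [this]
    refine Eq.trans ?_ (Matrix.submatrix_mul_equiv _ _ _ finSumFinEquiv.symm _).symm
    rw [← Matrix.fromRows_toRows (A.submatrix (splitCols m) id),
      Matrix.fromBlocks_mul_fromRows, ← h₁.eq, ← h₂.eq,
      show (Matrix.of fun _ _ => (0 : K)) = (0 : Matrix (Fin (m / 2)) (Fin D₂.r) K) from rfl]
    simp
  · intro k l hkl
    obtain ⟨k, rfl⟩ := finSumFinEquiv.surjective k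
    obtain ⟨l, rfl⟩ := finSumFinEquiv.surjective l
    replace hkl := finSumFinEquiv_lt_iff.1 hkl
    rw [Fin.lt_def]
    rcases k with k | k <;> rcases l with l | l <;>
      simp only [LU.combine, Equiv.symm_apply_apply, Sum.map_inl, Sum.map_inr,
        splitCols_inl_val, splitCols_inr_val]
    · exact h₁.p_mono (Sum.lex_inl_inl.1 hkl)
    · have := (D₁.p k).2
      omega
    · exact absurd hkl Sum.lex_inr_inl
    · exact Nat.add_lt_add_left (h₂.p_mono (Sum.lex_inr_inr.1 hkl)) _
  · intro k
    obtain ⟨k, rfl⟩ := finSumFinEquiv.surjective k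
    rcases k with k | k
    · simpa [LU.combine] using h₁.L_pivot k
    · simpa [LU.combine] using h₂.L_pivot k
  · intro k i hi
    obtain ⟨k, rfl⟩ := finSumFinEquiv.surjective k
    obtain ⟨i, rfl⟩ := (splitCols m).surjective i
    rcases k with k | k <;> rcases i with i | i <;>
      simp only [Fin.lt_def, LU.combine, Equiv.symm_apply_apply, Sum.map_inl, Sum.map_inr,
        splitCols_inl_val, splitCols_inr_val, Matrix.submatrix_apply, Matrix.fromBlocks_apply₁₁,
        Matrix.fromBlocks_apply₁₂, Matrix.fromBlocks_apply₂₁, Matrix.fromBlocks_apply₂₂,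
        Matrix.of_apply] at hi ⊢
    · exact h₁.L_zero k i hi
    · have := (D₁.p k).2
      omega
    · exact h₂.L_zero k i (Fin.lt_def.2 (by omega))
  · intro k
    obtain ⟨k, rfl⟩ := finSumFinEquiv.surjective k
    rcases k with k | k
    · simpa [LU.combine] using h₁.U_pivot k
    · simpa [LU.combine] using h₂.U_pivot k
  · intro k j hj
    obtain ⟨k, rfl⟩ := finSumFinEquiv.surjective k
    rcases k with k | k
    · simpa [LU.combine] using h₁.U_zero k j (by simpa [LU.combine] using hj)
    · simpa [LU.combine] using h₂.U_zero k j (by simpa [LU.combine] using hj)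
  · intro k l hkl
    obtain ⟨k, rfl⟩ := finSumFinEquiv.surjective k
    obtain ⟨l, rfl⟩ := finSumFinEquiv.surjective l
    replace hkl := finSumFinEquiv_lt_iff.1 hkl
    rcases k with k | k <;> rcases l with l | l <;>
      simp only [LU.combine, Equiv.symm_apply_apply, Sum.elim_inl, Sum.elim_inr,
        Matrix.submatrix_apply, Matrix.fromRows_apply_inl, Matrix.fromRows_apply_inr, id]
    · exact h₁.U_upper k l (Sum.lex_inl_inl.1 hkl)
    · exact absurd hkl Sum.lex_inr_inl
    · exact congrFun (congrFun hU₂ k) l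
    · exact h₂.U_upper k l (Sum.lex_inr_inr.1 hkl)

end LU.IsEchelon

end LU

/-! ### PLUQ decompositions from echelon factorizations -/

section ToPLUQ

/-- The nonpivot rows and columns may follow in any order, since nothing triangular is asked of `M`
and `V`. -/
theorem exists_equiv_extending {r m : ℕ} {p : Fin r → Fin m} (hp : p.Injective) :
    ∃ P : Fin r ⊕ Fin (m - r) ≃ Fin m, ∀ k, P (Sum.inl k) = p k := by
  classical
  have hcard : Fintype.card {i // i ∉ Set.range p} = m - r := by
    rw [Fintype.card_subtype_compl, Fintype.card_fin]
    congr 1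
    rw [← Fintype.card_congr (Equiv.ofInjective p hp), Fintype.card_fin]
  refine ⟨(Equiv.sumCongr (Equiv.ofInjective p hp) (Fintype.equivFinOfCardEq hcard).symm).trans
    (Equiv.Set.sumCompl (Set.range p)), fun k => ?_⟩
  exact Equiv.Set.sumCompl_apply_inl _ _

open Classical in
/-- The PLUQ decomposition given by an echelon factorization. -/
noncomputable def LU.toPLUQ {m n : ℕ} {α : Type u} (D : LU m n α) : PLUQ m n α :=
  if h : D.p.Injective ∧ D.q.Injective then
    let P := (exists_equiv_extending h.1).choose
    let Q := (exists_equiv_extending h.2).choose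
    ⟨D.r, P, Q, D.L.submatrix (P ∘ Sum.inl) id, D.L.submatrix (P ∘ Sum.inr) id,
      D.U.submatrix id (Q ∘ Sum.inl), D.U.submatrix id (Q ∘ Sum.inr)⟩
  else
    -- A default value; pivots of an echelon factorization are always injective.
    ⟨0, finSumFinEquiv.trans (finCongr (by omega)), finSumFinEquiv.trans (finCongr (by omega)),
      Matrix.of fun k => k.elim0, Matrix.of fun _ k => k.elim0, Matrix.of fun k => k.elim0,
      Matrix.of fun k => k.elim0⟩

theorem LU.Valid.toPLUQ {K : Type u} {m n : ℕ} {D : LU m n Addr} {μ : List K} (h : D.Valid μ) :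
    D.toPLUQ.Valid μ := by
  unfold LU.toPLUQ
  split_ifs
  · exact ⟨fun _ _ => h.1 _ _, fun _ _ => h.1 _ _, fun _ _ => h.2 _ _, fun _ _ => h.2 _ _⟩
  · exact ⟨fun k => k.elim0, fun _ k => k.elim0, fun k => k.elim0, fun k => k.elim0⟩

variable {K : Type u} [Field K]

/-- The permutations depend only on the discrete data `p` and `q`, never on field elements, so the
conversion merely rearranges addresses and costs nothing. -/
theorem LU.val_toPLUQ {m n : ℕ} (D : LU m n Addr) (μ : List K) :
    D.toPLUQ.val μ = (D.val μ).toPLUQ := by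
  unfold LU.toPLUQ
  by_cases h : D.p.Injective ∧ D.q.Injective
  · rw [dif_pos h, dif_pos (show (D.val μ).p.Injective ∧ (D.val μ).q.Injective from h)]
    rfl
  · rw [dif_neg h, dif_neg (show ¬((D.val μ).p.Injective ∧ (D.val μ).q.Injective) from h)]
    simp only [PLUQ.val, PLUQ.mk.injEq, heq_eq_eq, true_and]
    refine ⟨?_, ?_, ?_, ?_⟩ <;> ext i j
    · exact i.elim0
    · exact j.elim0
    · exact i.elim0
    · exact i.elim0

theorem PLUQ.pivots_apply {m n : ℕ} {α : Type u} (D : PLUQ m n α) (s : Fin D.r ⊕ Fin (m - D.r))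
    (t : Fin D.r ⊕ Fin (n - D.r)) : D.pivots (D.P s) (D.Q t) =
      (Matrix.fromBlocks 1 0 0 0 : Matrix _ _ ℕ) s t := by
  simp [PLUQ.pivots]

theorem PLUQ.pivots_map_pivot {m n : ℕ} {α : Type u} (D : PLUQ m n α) (k : Fin D.r) :
    D.pivots.map (Nat.cast : ℕ → K) (D.P (Sum.inl k)) (D.Q (Sum.inl k)) = 1 := by
  simp [PLUQ.pivots_apply]

theorem PLUQ.pivots_map_eq_zero {m n : ℕ} {α : Type u} (D : PLUQ m n α) (i : Fin m) (j : Fin n)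
    (h : ∀ k, D.P (Sum.inl k) = i → D.Q (Sum.inl k) ≠ j) :
    D.pivots.map (Nat.cast : ℕ → K) i j = 0 := by
  obtain ⟨s, rfl⟩ := D.P.surjective i
  obtain ⟨t, rfl⟩ := D.Q.surjective j
  rw [Matrix.map_apply, PLUQ.pivots_apply]
  rcases s with s | s <;> rcases t with t | t
  · have : s ≠ t := by
      rintro rfl
      exact h s rfl rfl
    simp [this]
  all_goals simp

theorem PLUQ.rank_leading_pivots {m n : ℕ} {α : Type u} (D : PLUQ m n α) (a b : ℕ) :
    (leading (D.pivots.map (Nat.cast : ℕ → K)) a b).rank = Fintype.card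
      {k // (D.P (Sum.inl k) : ℕ) < a ∧ (D.Q (Sum.inl k) : ℕ) < b} :=
  rank_leading_perm (D.P.injective.comp Sum.inl_injective) (D.Q.injective.comp Sum.inl_injective)
    D.pivots_map_pivot D.pivots_map_eq_zero a b

theorem LU.IsEchelon.reveals {m n : ℕ} {D : LU m n K} {A : Matrix (Fin m) (Fin n) K}
    (h : D.IsEchelon A) : D.toPLUQ.Reveals A := by
  have hinj := And.intro h.p_mono.injective h.q_injective
  have hP := (exists_equiv_extending hinj.1).choose_spec
  have hQ := (exists_equiv_extending hinj.2).choose_spec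
  unfold LU.toPLUQ
  rw [dif_pos hinj]
  set P := (exists_equiv_extending hinj.1).choose
  set Q := (exists_equiv_extending hinj.2).choose
  have hP' : P ∘ Sum.inl = D.p := funext hP
  have hQ' : Q ∘ Sum.inl = D.q := funext hQ
  refine ⟨?_, ?_, ?_, ?_⟩
  · simp only [hP']
    exact h.isUnitLower
  · simp only [hQ']
    exact h.isNonsingUpper
  · have h₁ : D.L.submatrix P id = Matrix.fromRows (D.L.submatrix (P ∘ Sum.inl) id)
        (D.L.submatrix (P ∘ Sum.inr) id) := by
      ext (i | i) j <;> rfl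
    have h₂ : D.U.submatrix id Q = Matrix.fromCols (D.U.submatrix id (Q ∘ Sum.inl))
        (D.U.submatrix id (Q ∘ Sum.inr)) := by
      ext i (j | j) <;> rfl
    dsimp only
    rw [← h₁, ← h₂, h.eq]
    rfl
  · refine isRankProfileMatrix_of_rank_leading (p := D.p) (q := D.q) hinj.1 hinj.2 ?_ ?_
      h.rank_leading
    · intro k
      rw [← hP, ← hQ]
      exact PLUQ.pivots_map_pivot (⟨D.r, P, Q, D.L.submatrix (P ∘ Sum.inl) id,
        D.L.submatrix (P ∘ Sum.inr) id, D.U.submatrix id (Q ∘ Sum.inl),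
        D.U.submatrix id (Q ∘ Sum.inr)⟩ : PLUQ m n K) k
    · intro i j hij
      refine PLUQ.pivots_map_eq_zero _ i j fun k hk => ?_
      have hk' : P (Sum.inl k) = i := hk
      change Q (Sum.inl k) ≠ j
      rw [hQ]
      exact hij k (by rw [← hP, hk'])

end ToPLUQ

/-! ### Fast PLUQ decomposition -/

section FastPLUQ

variable {K : Type u} [Field K]

/-- The position of the first nonzero entry of a stored vector. -/
def firstNonzero : (n : ℕ) → (Fin n → Addr) → Prog K (Option (Fin n))
  | 0, _ => pure none
  | n + 1, v => do
    let t ← Prog.isZero (v 0) pure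
    if t then do
      let j ← firstNonzero n fun i => v i.succ
      pure (j.map Fin.succ)
    else pure (some 0)

theorem firstNonzero_spec (n : ℕ) (v : Fin n → Addr) (μ : List K) :
    (firstNonzero n v).Spec μ fun j ν c => ν = μ ∧ c ≤ n ∧
      (j = none → ∀ i, read μ (v i) = 0) ∧
      ∀ k, j = some k → read μ (v k) ≠ 0 ∧ ∀ i < k, read μ (v i) = 0 := by
  induction n with
  | zero => exact ⟨rfl, le_rfl, fun _ i => i.elim0, fun k => k.elim0⟩
  | succ n ih =>
    rw [firstNonzero]
    refine Prog.Spec.bind (Q₁ := fun t ν c => ν = μ ∧ c = 1 ∧ (t = true ↔ read μ (v 0) = 0))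
      ⟨rfl, rfl, by simp [Prog.run, Pure.pure]⟩ ?_
    rintro t ν _ - ⟨rfl, rfl, ht⟩
    by_cases h0 : read ν (v 0) = 0
    · rw [if_pos (ht.2 h0)]
      refine (ih fun i => v i.succ).bind ?_
      rintro j _ c - ⟨rfl, hc, hnone, hsome⟩
      refine Prog.Spec.pure ⟨rfl, by omega, ?_, ?_⟩
      · intro hj i
        refine Fin.cases h0 (fun i => ?_) i
        exact hnone (Option.map_eq_none_iff.1 hj) i
      · intro k hk
        obtain ⟨l, hl, rfl⟩ := Option.map_eq_some_iff.1 hk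
        refine ⟨(hsome l hl).1, fun i hi => ?_⟩
        induction i using Fin.cases with
        | zero => exact h0
        | succ i => exact (hsome l hl).2 i (Fin.succ_lt_succ_iff.1 hi)
    · rw [if_neg (fun h => h0 (ht.1 h))]
      refine Prog.Spec.pure ⟨rfl, by omega, by simp, ?_⟩
      rintro _ ⟨⟩
      exact ⟨h0, fun i hi => absurd hi (Fin.not_lt_zero i)⟩

/-- Echelon factorization by halving the set of rows. -/
def luProg (f : ∀ m k n : ℕ, AMat m n → AMat m k → AMat k n → Prog K (AMat m n))
    (g : ∀ m r : ℕ, AMat m r → AMat r r → Prog K (AMat m r)) (n : ℕ) :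
    (m : ℕ) → AMat m n → Prog K (LU m n Addr)
  | 0, _ => pure (LU.empty 0 n Addr)
  | 1, A => do
    let one ← Prog.const 1 pure
    let j ← firstNonzero n (A 0)
    pure (j.elim (LU.empty 1 n Addr) fun j => LU.row one (A 0) j)
  | m + 2, A => do
    let A' := A.submatrix (splitCols (m + 2)) id
    let D₁ ← luProg f g n ((m + 2) / 2) A'.toRows₁
    let E ← g _ _ (A'.toRows₂.submatrix id D₁.q) (D₁.U.submatrix id D₁.q)
    let G ← f _ _ _ A'.toRows₂ E D₁.U
    let D₂ ← luProg f g n (m + 2 - (m + 2) / 2) G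
    let z ← Prog.const 0 pure
    pure (LU.combine z D₁ D₂ E)
termination_by m => m
decreasing_by all_goals omega

/-- For `β ≥ 1` the power is superadditive and `γ = 1/2` works; for `β ≤ 1` concavity at the
midpoint gives `γ = 2⁻¹ ^ β`, which is below `1` because `β > 0`. The strict inequality `γ < 1`
keeps a logarithm out of the PLUQ cost. -/
theorem exists_rpow_add_rpow_le {β : ℝ} (hβ : 0 < β) :
    ∃ γ : ℝ, γ < 1 ∧ ∀ x y : ℝ, 0 ≤ x → 0 ≤ y → x ^ β + y ^ β ≤ 2 * γ * (x + y) ^ β := by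
  rcases le_total 1 β with h | h
  · refine ⟨1 / 2, by norm_num, fun x y hx hy => ?_⟩
    simpa using Real.add_rpow_le_rpow_add hx hy h
  · refine ⟨2⁻¹ ^ β, Real.rpow_lt_one (by norm_num) (by norm_num) hβ, fun x y hx hy => ?_⟩
    have := (Real.concaveOn_rpow hβ.le h).2 (Set.mem_Ici.2 hx) (Set.mem_Ici.2 hy)
      (show (0 : ℝ) ≤ 2⁻¹ by norm_num) (show (0 : ℝ) ≤ 2⁻¹ by norm_num) (by norm_num)
    simp only [smul_eq_mul] at this
    rw [← mul_add, ← mul_add, Real.mul_rpow (by norm_num) (add_nonneg hx hy)] at this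
    linarith

theorem rpow_sub_one_eq {ω : ℝ} (hω : 2 < ω) (r : ℕ) :
    (r : ℝ) ^ (ω - 1) = r * (r : ℝ) ^ (ω - 2) := by
  rcases Nat.eq_zero_or_pos r with rfl | hr
  · rw [Nat.cast_zero, Real.zero_rpow (by linarith), zero_mul]
  · rw [show ω - 1 = 1 + (ω - 2) by ring, Real.rpow_add (by exact_mod_cast hr), Real.rpow_one]

/-- The ranks of the two halves add up to the total rank, so the rank-dependent costs combine
through `hγ`, leaving room for the solve and the update. The summand `1` accounts for the zero tests
at the leaves and merely doubles with the number of rows. -/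
theorem luProg_spec {f : ∀ m k n : ℕ, AMat m n → AMat m k → AMat k n → Prog K (AMat m n)}
    {g : ∀ m r : ℕ, AMat m r → AMat r r → Prog K (AMat m r)} {ω C C' a γ : ℝ} (hω : 2 < ω)
    (hC : 0 ≤ C) (hC' : 0 ≤ C') (hf : MulSubSpec f ω C) (hg : SolveUpperSpec g ω C')
    (ha : 0 ≤ a) (haγ : 2 * γ * a + (C + C') ≤ 2 * a)
    (hγ : ∀ x y : ℝ, 0 ≤ x → 0 ≤ y → x ^ (ω - 2) + y ^ (ω - 2) ≤ 2 * γ * (x + y) ^ (ω - 2))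
    (n m : ℕ) (A : AMat m n) (μ : List K) (hA : A.Valid μ) (κ : ℕ) (hκ : m ≤ 2 ^ κ) :
    (luProg f g n m A).Spec μ fun D ν c =>
      D.Valid ν ∧ (D.val ν).IsEchelon (A.val μ) ∧
      (c : ℝ) ≤ n * 2 ^ κ * (a * (D.r : ℝ) ^ (ω - 2) + 1) := by
  induction m using Nat.strong_induction_on generalizing μ κ with
  | _ m ih =>
  match m, ih with
  | 0, _ =>
    rw [luProg]
    refine Prog.Spec.pure ⟨⟨fun i => i.elim0, fun k => k.elim0⟩, ?_, ?_⟩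
    · rw [LU.val_empty, show A.val μ = 0 by ext i; exact i.elim0]
      exact LU.IsEchelon.empty_zero
    · rw [Nat.cast_zero]
      positivity
  | 1, _ =>
    rw [luProg]
    refine (Prog.Spec.const 1 μ).bind ?_
    rintro one ν _ hν ⟨hone, hone1, rfl⟩
    refine (firstNonzero_spec n (A 0) ν).bind ?_
    rintro j ν c - ⟨rfl, hc, hnone, hsome⟩
    have hcost : ∀ r : ℕ,
        ((0 + (c + 0) : ℕ) : ℝ) ≤ n * 2 ^ κ * (a * (r : ℝ) ^ (ω - 2) + 1) := by
      intro r
      have h1 : (1 : ℝ) ≤ 2 ^ κ := one_le_pow₀ (by norm_num)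
      have h2 : (1 : ℝ) ≤ a * (r : ℝ) ^ (ω - 2) + 1 := le_add_of_nonneg_left (by positivity)
      have h3 : (c : ℝ) ≤ n := by exact_mod_cast hc
      calc ((0 + (c + 0) : ℕ) : ℝ) ≤ n * 1 * 1 := by simpa using h3
        _ ≤ _ := by gcongr
    have hval : A.val μ = Matrix.of fun _ j => read ν (A 0 j) := by
      ext i j
      rw [Subsingleton.elim i 0]
      exact (read_of_prefix hν (hA 0 j)).symm
    rw [hval]
    refine Prog.Spec.pure ?_
    rcases j with _ | j
    · refine ⟨⟨fun _ k => k.elim0, fun k => k.elim0⟩, ?_, hcost _⟩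
      change ((LU.empty 1 n Addr).val ν).IsEchelon _
      rw [LU.val_empty, show (Matrix.of fun _ j => read ν (A 0 j)) = (0 : Matrix (Fin 1) (Fin n) K)
        by ext i j; exact hnone rfl j]
      exact LU.IsEchelon.empty_zero
    · refine ⟨⟨fun _ _ => hone, fun _ _ => hA.mono hν _ _⟩, ?_, hcost _⟩
      have := LU.IsEchelon.row (hsome j rfl).1 (hsome j rfl).2
      rw [← hone1] at this
      exact this
  | m + 2, ih =>
    rw [luProg]
    obtain ⟨κ, rfl⟩ : ∃ k, κ = k + 1 := by
      rcases κ with _ | k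
      · simp at hκ
      · exact ⟨k, rfl⟩
    rw [pow_succ] at hκ
    set A' := A.submatrix (splitCols (m + 2)) id
    have vA₁ : AMat.Valid A'.toRows₁ μ := fun i j => hA _ _
    have vA₂ : AMat.Valid A'.toRows₂ μ := fun i j => hA _ _
    refine (ih ((m + 2) / 2) (by omega) _ μ vA₁ κ (by omega)).bind ?_
    rintro D₁ ν₁ c₁ hν₁ ⟨vD₁, hD₁, hc₁⟩
    have vA₂q : AMat.Valid (A'.toRows₂.submatrix id D₁.q) μ := fun i j => hA _ _
    have vU : AMat.Valid D₁.U ν₁ := vD₁.2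
    have vUq : AMat.Valid (D₁.U.submatrix id D₁.q) ν₁ := fun i j => vD₁.2 _ _
    have hUq : IsNonsingUpper (AMat.val (D₁.U.submatrix id D₁.q) ν₁) := hD₁.isNonsingUpper
    refine (hg _ _ _ _ ν₁ (vA₂q.mono hν₁) vUq hUq).bind ?_
    rintro E ν₂ c₂ hν₂ ⟨vE, hE, hc₂⟩
    refine (hf _ _ _ _ _ _ ν₂ (vA₂.mono (hν₁.trans hν₂)) vE (vU.mono hν₂)).bind ?_
    rintro G ν₃ c₃ hν₃ ⟨vG, hG, hc₃⟩
    refine (ih (m + 2 - (m + 2) / 2) (by omega) _ ν₃ vG κ (by omega)).bind ?_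
    rintro D₂ ν₄ c₄ hν₄ ⟨vD₂, hD₂, hc₄⟩
    refine (Prog.Spec.const 0 ν₄).bind ?_
    rintro z ν₅ _ hν₅ ⟨hz, hz0, rfl⟩
    have h35 := hν₄.trans hν₅
    have h25 := hν₃.trans h35
    have h15 := hν₂.trans h25
    refine Prog.Spec.pure ⟨(vD₁.mono h15).combine hz (vD₂.mono hν₅) (vE.mono h25), ?_, ?_⟩
    · rw [LU.val_combine, hz0]
      refine LU.IsEchelon.combine (by rw [vD₁.val_eq h15]; exact hD₁) ?_ ?_
      · change E.val ν₅ * AMat.val (D₁.U.submatrix id D₁.q) ν₅ =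
          AMat.val (A'.toRows₂.submatrix id D₁.q) μ
        rw [vE.val_eq h25, vUq.val_eq h15, hE, vA₂q.val_eq hν₁]
        exact Matrix.nonsing_inv_mul_cancel_right _ _ hUq.isUnit_det
      · change (D₂.val ν₅).IsEchelon (AMat.val A'.toRows₂ μ - E.val ν₅ * AMat.val D₁.U ν₅)
        rw [vD₂.val_eq hν₅, vE.val_eq h25, vU.val_eq h15, ← vA₂.val_eq (hν₁.trans hν₂),
          ← vU.val_eq hν₂, ← hG]
        exact hD₂
    · have hr₁ := hD₁.r_le_height
      have hr₂ := hD₁.r_le_width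
      change D₁.r ≤ _ at hr₁ hr₂
      have hM : ((max (m + 2 - (m + 2) / 2) D₁.r : ℕ) : ℝ) ≤ 2 ^ κ := by
        exact_mod_cast max_le (by omega) (by omega)
      have hn : ((max n D₁.r : ℕ) : ℝ) ≤ n := by exact_mod_cast max_le le_rfl hr₂
      have hr₂' : (D₁.r : ℝ) ≤ n := by exact_mod_cast hr₂
      set w := (D₁.r : ℝ) ^ (ω - 2)
      have hw : 0 ≤ w := by positivity
      have e₂ : (c₂ : ℝ) ≤ C' * (2 ^ κ) * (n * w) := by
        refine hc₂.trans ?_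
        rw [rpow_sub_one_eq hω]
        gcongr
      have e₃ : (c₃ : ℝ) ≤ C * (2 ^ κ) * n * w := by
        refine hc₃.trans ?_
        gcongr
      have hγ' := hγ D₁.r D₂.r (by positivity) (by positivity)
      have hW : 0 ≤ ((D₁.r : ℝ) + D₂.r) ^ (ω - 2) := by positivity
      have hwW : w ≤ ((D₁.r : ℝ) + D₂.r) ^ (ω - 2) :=
        Real.rpow_le_rpow (by positivity) (by simp) (by linarith)
      -- The recurrence divided by `n * 2 ^ κ`, without the leaf terms.
      have key : a * (w + (D₂.r : ℝ) ^ (ω - 2)) + (C + C') * w ≤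
          2 * a * ((D₁.r : ℝ) + D₂.r) ^ (ω - 2) := by
        have h1 := mul_le_mul_of_nonneg_left hγ' ha
        have h2 := mul_le_mul_of_nonneg_left hwW (add_nonneg hC hC')
        have h3 := mul_le_mul_of_nonneg_right haγ hW
        linarith
      have key' := mul_le_mul_of_nonneg_left key (show (0 : ℝ) ≤ n * 2 ^ κ by positivity)
      change _ ≤ (n : ℝ) * 2 ^ (κ + 1) * (a * ((D₁.r + D₂.r : ℕ) : ℝ) ^ (ω - 2) + 1)
      push_cast
      rw [pow_succ]
      linarith

theorem exists_fast_subroutines {ω : ℝ} (hω : 2 < ω) (h : MatMulExponent K ω) :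
    ∃ (S : Subroutines K) (C : ℝ), S.Correct ∧ S.CostBound ω C := by
  obtain ⟨f, C₁, hC₁, hf⟩ := exists_mulSubSpec hω h
  obtain ⟨g, C₂, hC₂, hg⟩ := exists_solveUpperSpec hω hC₁ hf
  obtain ⟨γ, hγ1, hγ⟩ := exists_rpow_add_rpow_le (show 0 < ω - 2 by linarith)
  -- The solution of `2 γ a + (C₁ + C₂) = 2 a`.
  set a := (C₁ + C₂) / (2 * (1 - γ))
  have hγ1' : 0 < 1 - γ := by linarith
  have ha : 0 ≤ a := by positivity
  have haγ : 2 * γ * a + (C₁ + C₂) ≤ 2 * a := by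
    have : a * (2 * (1 - γ)) = C₁ + C₂ := div_mul_cancel₀ _ (by positivity)
    linarith
  have hlu := luProg_spec hω hC₁ hC₂ hf hg ha haγ hγ
  -- The factor `2` comes from rounding `m` up to a power of two, and `a + 1` from absorbing the
  -- leaf term into the power of `max r 1`.
  set C := C₁ + C₂ + 2 * (a + 1)
  have hpluq : ∀ (m n : ℕ) (A : AMat m n) (μ : List K), A.Valid μ →
      (luProg f g n m A >>= fun D => pure D.toPLUQ).Spec μ fun D ν c =>
        D.Valid ν ∧ (D.val ν).Reveals (A.val μ) ∧
        (c : ℝ) ≤ C * m * n * ((max (A.val μ).rank 1 : ℕ) : ℝ) ^ (ω - 2) := by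
    intro m n A μ hA
    -- For `m = 0` the power `2 ^ Nat.clog 2 m` is `1` and exceeds `2 m`.
    rcases Nat.eq_zero_or_pos m with rfl | hm
    · rw [luProg]
      refine Prog.Spec.bind (Q₁ := fun D ν c => D = LU.empty 0 n Addr ∧ c = 0) ⟨rfl, rfl⟩ ?_
      rintro _ ν _ - ⟨rfl, rfl⟩
      refine Prog.Spec.pure ⟨LU.Valid.toPLUQ ⟨fun i => i.elim0, fun k => k.elim0⟩, ?_, by simp⟩
      rw [LU.val_toPLUQ, LU.val_empty, show A.val μ = 0 by ext i; exact i.elim0]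
      exact LU.IsEchelon.empty_zero.reveals
    refine (hlu n m A μ hA (Nat.clog 2 m) (Nat.le_pow_clog one_lt_two m)).bind ?_
    rintro D ν c - ⟨vD, hD, hc⟩
    refine Prog.Spec.pure ⟨vD.toPLUQ, by rw [LU.val_toPLUQ]; exact hD.reveals, ?_⟩
    have hr : (A.val μ).rank = D.r := hD.rank_eq
    rw [hr, add_zero]
    have h1 : (1 : ℝ) ≤ ((max D.r 1 : ℕ) : ℝ) ^ (ω - 2) :=
      Real.one_le_rpow (by exact_mod_cast le_max_right _ _) (by linarith)
    have h2 : (D.r : ℝ) ^ (ω - 2) ≤ ((max D.r 1 : ℕ) : ℝ) ^ (ω - 2) :=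
      Real.rpow_le_rpow (by positivity) (by exact_mod_cast le_max_left _ _) (by linarith)
    have h3 : (2 : ℝ) ^ Nat.clog 2 m ≤ 2 * m := by exact_mod_cast two_pow_clog_le hm
    set w := ((max D.r 1 : ℕ) : ℝ) ^ (ω - 2)
    calc (c : ℝ) ≤ n * 2 ^ Nat.clog 2 m * (a * (D.r : ℝ) ^ (ω - 2) + 1) := hc
      _ ≤ n * (2 * m) * (a * w + w) := by gcongr
      _ = 2 * (a + 1) * m * n * w := by ring
      _ ≤ C * m * n * w := by
          have : 2 * (a + 1) ≤ C := le_add_of_nonneg_left (by positivity)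
          gcongr
  -- Lower systems are transposed upper ones, and transposing addresses is free.
  have hlow : ∀ (r n : ℕ) (L : AMat r r) (B : AMat r n) (μ : List K), L.Valid μ → B.Valid μ →
      IsUnitLower (L.val μ) →
      (g n r B.transpose L.transpose >>= fun X => pure X.transpose).Spec μ fun R ν c =>
        AMat.Valid R ν ∧ AMat.val R ν = (L.val μ)⁻¹ * B.val μ ∧
        (c : ℝ) ≤ C₂ * (max n r : ℕ) * (r : ℝ) ^ (ω - 1) := by
    intro r n L B μ hL hB hL'
    refine (hg n r B.transpose L.transpose μ (fun i j => hB j i) (fun i j => hL j i) hL'.transpose).bind ?_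
    rintro X ν c - ⟨vX, hX, hc⟩
    refine Prog.Spec.pure ⟨fun i j => vX j i, ?_, hc⟩
    rw [AMat.val_transpose, hX, AMat.val_transpose, AMat.val_transpose, Matrix.transpose_mul,
      Matrix.transpose_nonsing_inv, Matrix.transpose_transpose, Matrix.transpose_transpose]
  have hCC₁ : C₁ ≤ C := by linarith
  have hCC₂ : C₂ ≤ C := by linarith
  refine ⟨⟨fun m n A => luProg f g n m A >>= fun D => pure D.toPLUQ,
    fun r n L B => g n r B.transpose L.transpose >>= fun X => pure X.transpose, g, f⟩, C,
    ⟨?_, ?_, ?_, ?_⟩, ⟨?_, ?_, ?_, ?_⟩⟩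
  · exact fun m n A μ hA => ⟨(hpluq m n A μ hA).1, (hpluq m n A μ hA).2.1⟩
  · intro r n L B μ hL hB hL'
    obtain ⟨h1, h2, -⟩ := hlow r n L B μ hL hB hL'
    exact ⟨h1, h2⟩
  · intro m r X U μ hX hU hU'
    obtain ⟨h1, h2, -⟩ := hg m r X U μ hX hU hU'
    exact ⟨h1, h2⟩
  · intro m k n B X Y μ hB hX hY
    obtain ⟨h1, h2, -⟩ := hf m k n B X Y μ hB hX hY
    exact ⟨h1, h2⟩
  · exact fun m n A μ hA => (hpluq m n A μ hA).2.2
  · intro r n L B μ hL hB hL'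
    refine (hlow r n L B μ hL hB hL').2.2.trans ?_
    gcongr
  · intro m r X U μ hX hU hU'
    refine (hg m r X U μ hX hU hU').2.2.trans ?_
    gcongr
  · intro m k n B X Y μ hB hX hY
    refine (hf m k n B X Y μ hB hX hY).2.2.trans ?_
    have : (k : ℝ) ^ (ω - 2) ≤ ((max k 1 : ℕ) : ℝ) ^ (ω - 2) :=
      Real.rpow_le_rpow (by positivity) (by exact_mod_cast le_max_left _ _) (by linarith)
    gcongr

end FastPLUQ

/-! ### Ranks of leading submatrices after block elimination -/

section BlockElimination

variable {K : Type u} [Field K]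

theorem range_mulVecLin_fromCols {m n₁ n₂ : Type*} [Fintype n₁] [Fintype n₂]
    (M : Matrix m n₁ K) (N : Matrix m n₂ K) :
    (Matrix.fromCols M N).mulVecLin.range = M.mulVecLin.range ⊔ N.mulVecLin.range := by
  have : Set.range (Matrix.fromCols M N).col = Set.range M.col ∪ Set.range N.col := by
    rw [← Set.Sum.elim_range]
    congr 1
    funext j
    rcases j with j | j <;> rfl
  rw [Matrix.range_mulVecLin, Matrix.range_mulVecLin, Matrix.range_mulVecLin, this,
    Submodule.span_union]

/-- If the rows of `X` at the positions `p` are linearly independent and as many as the rank of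
`X Y`, and the rows of `H` at these positions vanish, then `[X Y, X D + H]` has the rank of `X Y`
plus that of `H`. -/
theorem rank_fromCols_mul_add {I J J' ι S : Type*} [Fintype I] [Fintype J] [Fintype J'] [Fintype ι]
    [DecidableEq ι] [Fintype S] [DecidableEq S] {X : Matrix I ι K} {Y : Matrix ι J K}
    {D : Matrix ι J' K} {H : Matrix I J' K} {p : S → I} {W : Matrix ι S K} {Z : Matrix J ι K}
    (hW : X.submatrix p id * W = 1) (hZ : Y * Z = 1) (hH : ∀ s j, H (p s) j = 0)
    (hrank : (X * Y).rank ≤ Fintype.card S) :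
    (Matrix.fromCols (X * Y) (X * D + H)).rank = (X * Y).rank + H.rank := by
  -- `Y` has a right inverse, so multiplying by it does not shrink the column space.
  have hXY : (X * Y).mulVecLin.range = X.mulVecLin.range := by
    apply le_antisymm
    · rw [Matrix.mulVecLin_mul]
      exact LinearMap.range_comp_le_range _ _
    · have : X = X * Y * Z := by rw [Matrix.mul_assoc, hZ, Matrix.mul_one]
      conv_lhs => rw [this, Matrix.mulVecLin_mul]
      exact LinearMap.range_comp_le_range _ _
  have hsup : X.mulVecLin.range ⊔ (X * D + H).mulVecLin.range =
      X.mulVecLin.range ⊔ H.mulVecLin.range := by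
    have hXD : (X * D).mulVecLin.range ≤ X.mulVecLin.range := by
      rw [Matrix.mulVecLin_mul]
      exact LinearMap.range_comp_le_range _ _
    apply le_antisymm
    · refine sup_le le_sup_left ?_
      rintro _ ⟨v, rfl⟩
      rw [Matrix.mulVecLin_add]
      exact Submodule.add_mem_sup (hXD ⟨v, rfl⟩) ⟨v, rfl⟩
    · refine sup_le le_sup_left ?_
      rintro _ ⟨v, rfl⟩
      have : H.mulVecLin v = -(X * D).mulVecLin v + (X * D + H).mulVecLin v := by
        rw [Matrix.mulVecLin_add]
        simp
      rw [this]
      exact Submodule.add_mem_sup (Submodule.neg_mem _ (hXD ⟨v, rfl⟩)) ⟨v, rfl⟩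
  let g : (I → K) →ₗ[K] (S → K) := LinearMap.funLeft K K p
  -- Restriction to the rows `p` maps the column space of `X` onto `S → K`, since `W` is a right
  -- inverse; the rank bound makes the dimensions equal, so it is injective.
  have hker : ∀ x ∈ X.mulVecLin.range, g x = 0 → x = 0 := by
    have hsurj : Function.Surjective (g.domRestrict X.mulVecLin.range) := by
      intro y
      refine ⟨⟨X.mulVecLin (W.mulVec y), ⟨_, rfl⟩⟩, ?_⟩
      have : (X.submatrix p id * W).mulVec y = y := by rw [hW, Matrix.one_mulVec]
      rw [← Matrix.mulVec_mulVec] at this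
      exact this
    have hfin : Module.finrank K X.mulVecLin.range = Module.finrank K (S → K) := by
      apply le_antisymm
      · rw [← hXY, Module.finrank_fintype_fun_eq_card]
        exact hrank
      · exact LinearMap.finrank_le_finrank_of_surjective hsurj
    have hinj := (LinearMap.injective_iff_surjective_of_finrank_eq_finrank hfin).2 hsurj
    intro x hx hgx
    have : (⟨x, hx⟩ : X.mulVecLin.range) = 0 := hinj (by simpa using hgx)
    simpa using this
  have hdisj : X.mulVecLin.range ⊓ H.mulVecLin.range = ⊥ := by
    rw [Submodule.eq_bot_iff]
    rintro _ ⟨hx, ⟨v, rfl⟩⟩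
    refine hker _ hx ?_
    funext s
    simp [g, LinearMap.funLeft_apply, Matrix.mulVec, dotProduct, hH]
  have h := Submodule.finrank_sup_add_finrank_inf_eq X.mulVecLin.range H.mulVecLin.range
  rw [hdisj, finrank_bot, add_zero, ← hsup, ← hXY, ← range_mulVecLin_fromCols] at h
  exact h

/-- The first `k` elements of `Fin a` and `Fin m`, for `k ≤ a` and a value preserving map. -/
def leadingEquiv {a m k : ℕ} {f : Fin a → Fin m} (hf : ∀ i, (f i : ℕ) = i) (hk : k ≤ a) :
    {i : Fin a // (i : ℕ) < k} ≃ {i : Fin m // (i : ℕ) < k} where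
  toFun i := ⟨f i, by rw [hf]; exact i.2⟩
  invFun i := ⟨⟨i, i.2.trans_le hk⟩, i.2⟩
  left_inv i := Subtype.ext (Fin.ext (hf i))
  right_inv i := Subtype.ext (Fin.ext (hf _))

theorem rank_leading_submatrix {m n a b : ℕ} (A : Matrix (Fin m) (Fin n) K) {f : Fin a → Fin m}
    (hf : ∀ i, (f i : ℕ) = i) {g : Fin b → Fin n} (hg : ∀ j, (g j : ℕ) = j) {k l : ℕ} (hk : k ≤ a)
    (hl : l ≤ b) : (leading (A.submatrix f g) k l).rank = (leading A k l).rank :=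
  Matrix.rank_submatrix (leading A k l) (leadingEquiv hf hk) (leadingEquiv hg hl)

/-- The rank of a leading submatrix extending over the block `X Y` into the block next to it. -/
theorem rank_leading_of_elimination {m n a b c r : ℕ} {A : Matrix (Fin m) (Fin n) K}
    {er : Fin a → Fin m} (her : ∀ i, (er i : ℕ) = i) {ec : Fin b ⊕ Fin c → Fin n}
    (hec₁ : ∀ j, (ec (Sum.inl j) : ℕ) = j) (hec₂ : ∀ j, (ec (Sum.inr j) : ℕ) = b + j)
    (hn : n = b + c) {X : Matrix (Fin a) (Fin r) K} {Y : Matrix (Fin r) (Fin b) K}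
    {D : Matrix (Fin r) (Fin c) K} {H : Matrix (Fin a) (Fin c) K} {p : Fin r → Fin a}
    {q : Fin r → Fin b} (h₁ : A.submatrix er (ec ∘ Sum.inl) = X * Y)
    (h₂ : A.submatrix er (ec ∘ Sum.inr) = X * D + H) (hp : IsUnit (X.submatrix p id).det)
    (hq : IsUnit (Y.submatrix id q).det) (hH : ∀ k j, H (p k) j = 0)
    (hXY : ∀ k ≤ a, (leading (X * Y) k b).rank = Fintype.card {s // (p s : ℕ) < k}) {k : ℕ}
    (hk : k ≤ a) (l : ℕ) :
    (leading A k (b + l)).rank = (leading A k b).rank + (leading H k l).rank := by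
  have key : ∀ l, (leading A k (b + l)).rank = (leading (X * Y) k b).rank
      + (leading H k l).rank := by
    intro l
    set Xk : Matrix {i : Fin a // (i : ℕ) < k} (Fin r) K := X.submatrix Subtype.val id
    set Dl : Matrix (Fin r) {j : Fin c // (j : ℕ) < l} K := D.submatrix id Subtype.val
    -- Here `S` consists of the pivots in the first `k` rows. `W` keeps their columns of the inverse
    -- of the full pivot block of `X`, and `Z` selects the pivot columns of `Y` and inverts them.
    have h := rank_fromCols_mul_add (X := Xk) (Y := Y) (D := Dl) (H := leading H k l)
      (p := fun s : {s // (p s : ℕ) < k} => ⟨p s, s.2⟩)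
      (W := ((X.submatrix p id)⁻¹).submatrix id Subtype.val)
      (Z := (1 : Matrix (Fin b) (Fin b) K).submatrix id q * (Y.submatrix id q)⁻¹)
      ?_ ?_ ?_ ?_
    · rw [rank_leading_width]
      change _ = (Xk * Y).rank + _
      rw [← h]
      -- The first `b + l` columns are all those of the left block followed by the first `l` of the
      -- right block.
      have e₂ : Function.Bijective (Sum.elim
          (fun j : Fin b => (⟨ec (Sum.inl j), by rw [hec₁]; omega⟩ : {j : Fin n // (j : ℕ) < b + l}))
          (fun j : {j : Fin c // (j : ℕ) < l} => ⟨ec (Sum.inr j), by rw [hec₂]; omega⟩)) := by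
        constructor
        · rintro (j | j) (j' | j') hjj <;>
            simp only [Sum.elim_inl, Sum.elim_inr, Subtype.mk.injEq, Fin.ext_iff, hec₁,
              hec₂] at hjj
          · exact congrArg _ (Fin.ext hjj)
          · omega
          · omega
          · exact congrArg _ (Subtype.ext (Fin.ext (by omega)))
        · rintro ⟨j, hj⟩
          rcases lt_or_ge (j : ℕ) b with hjb | hjb
          · exact ⟨Sum.inl ⟨j, hjb⟩, Subtype.ext (Fin.ext (hec₁ _))⟩
          · have := j.2
            refine ⟨Sum.inr ⟨⟨j - b, by omega⟩, by simp; omega⟩, Subtype.ext (Fin.ext ?_)⟩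
            change (ec (Sum.inr _) : ℕ) = j
            rw [hec₂]
            simp
            omega
      rw [← Matrix.rank_submatrix (leading A k (b + l)) (leadingEquiv her hk)
        (Equiv.ofBijective _ e₂)]
      congr 1
      ext i j
      rcases j with j | j
      · exact congrFun (congrFun h₁ i.1) j
      · exact congrFun (congrFun h₂ i.1) j.1
    · have := Matrix.mul_nonsing_inv _ hp
      ext s t
      have := congrFun (congrFun this s.1) t.1
      simp only [Matrix.one_apply, ← Subtype.ext_iff] at this ⊢
      exact this
    · rw [← Matrix.mul_assoc]
      have : Y * (1 : Matrix (Fin b) (Fin b) K).submatrix id q = Y.submatrix id q := by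
        have h := Matrix.submatrix_mul Y (1 : Matrix (Fin b) (Fin b) K) id id q Function.bijective_id
        rw [Matrix.mul_one] at h
        exact h.symm
      rw [this, Matrix.mul_nonsing_inv _ hq]
    · exact fun s j => hH _ _
    · rw [← hXY k hk, rank_leading_width]
      exact le_rfl
  -- At `l = 0` this identifies the leading rank of `X Y` with that of `A`.
  have h0 := key 0
  rw [rank_leading_zero, add_zero, add_zero] at h0
  rw [key, h0]

end BlockElimination

/-! ### Leading ranks next to and below a block decomposed by PLUQ. -/

section Reveals

variable {K : Type u}

/-- The factor `P [L; M]` of a PLUQ decomposition. -/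
def PLUQ.left {m n : ℕ} (D : PLUQ m n K) : Matrix (Fin m) (Fin D.r) K :=
  (Matrix.fromRows D.L D.M).submatrix D.P.symm id

/-- The factor `[U V] Q` of a PLUQ decomposition. -/
def PLUQ.right {m n : ℕ} (D : PLUQ m n K) : Matrix (Fin D.r) (Fin n) K :=
  (Matrix.fromCols D.U D.V).submatrix id D.Q.symm

theorem PLUQ.left_submatrix {m n : ℕ} (D : PLUQ m n K) : D.left.submatrix (D.P ∘ Sum.inl) id = D.L := by
  ext i j
  simp [PLUQ.left]

theorem PLUQ.right_submatrix {m n : ℕ} (D : PLUQ m n K) : D.right.submatrix id (D.Q ∘ Sum.inl) = D.U := by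
  ext i j
  simp [PLUQ.right]

namespace PLUQ.Reveals

variable [Field K] {a b : ℕ} {D : PLUQ a b K} {A₁ : Matrix (Fin a) (Fin b) K}

theorem eq_left_mul_right (h : D.Reveals A₁) : A₁ = D.left * D.right := by
  have : A₁ = (Matrix.fromRows D.L D.M * Matrix.fromCols D.U D.V).submatrix D.P.symm D.Q.symm := by
    rw [← h.eq]
    ext i j
    simp
  exact this

theorem isUnit_det_L (h : D.Reveals A₁) : IsUnit D.L.det := by
  rw [← Matrix.det_transpose]
  exact h.lower.transpose.isUnit_det

theorem rank_leading (h : D.Reveals A₁) {k l : ℕ} (hk : k ≤ a) (hl : l ≤ b) :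
    (leading A₁ k l).rank = Fintype.card
      {s // (D.P (Sum.inl s) : ℕ) < k ∧ (D.Q (Sum.inl s) : ℕ) < l} := by
  rw [← h.rpm.leading_rank k l hk hl, PLUQ.rank_leading_pivots]

theorem rank_eq (h : D.Reveals A₁) : A₁.rank = D.r := by
  rw [← rank_leading_self, h.rank_leading le_rfl le_rfl]
  simp

variable {m n c d : ℕ} {A : Matrix (Fin m) (Fin n) K} {er : Fin a ⊕ Fin d → Fin m}
  {ec : Fin b ⊕ Fin c → Fin n}

/-- The choice of `X` and `F` says precisely that the right block is `P [L; M] X + P [0; F]`, with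
the second summand zero in the pivot rows. That the pivots reveal the rank profile supplies the
count of pivot rows required by `rank_leading_of_elimination`. -/
theorem rank_leading_right (her : ∀ i, (er (Sum.inl i) : ℕ) = i)
    (hec₁ : ∀ j, (ec (Sum.inl j) : ℕ) = j) (hec₂ : ∀ j, (ec (Sum.inr j) : ℕ) = b + j)
    (hn : n = b + c) (h : D.Reveals (A.submatrix er ec).toBlocks₁₁) {X : Matrix (Fin D.r) (Fin c) K}
    {F : Matrix (Fin (a - D.r)) (Fin c) K}
    (hX : X = D.L⁻¹ * ((A.submatrix er ec).toBlocks₁₂.submatrix D.P id).toRows₁)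
    (hF : F = ((A.submatrix er ec).toBlocks₁₂.submatrix D.P id).toRows₂ - D.M * X) {k : ℕ}
    (hk : k ≤ a) (l : ℕ) :
    (leading A k (b + l)).rank = (leading A k b).rank +
      (leading ((Matrix.fromRows 0 F).submatrix D.P.symm id) k l).rank := by
  refine rank_leading_of_elimination (er := er ∘ Sum.inl) (ec := ec) (X := D.left) (Y := D.right)
    (D := X) (p := D.P ∘ Sum.inl) (q := D.Q ∘ Sum.inl) her hec₁ hec₂ hn h.eq_left_mul_right ?_ ?_ ?_
    ?_ ?_ hk l
  · have hLX : D.L * X = ((A.submatrix er ec).toBlocks₁₂.submatrix D.P id).toRows₁ := by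
      rw [hX, Matrix.mul_nonsing_inv_cancel_left _ _ h.isUnit_det_L]
    have hsub : (A.submatrix er ec).toBlocks₁₂.submatrix D.P id =
        Matrix.fromRows D.L D.M * X + Matrix.fromRows 0 F := by
      rw [Matrix.fromRows_mul, hLX, hF, ← Matrix.fromRows_toRows
        ((A.submatrix er ec).toBlocks₁₂.submatrix D.P id)]
      ext (i | i) j <;> simp
    ext i j
    obtain ⟨s, rfl⟩ := D.P.surjective i
    have := congrFun (congrFun hsub s) j
    simp only [Matrix.add_apply, Matrix.mul_apply, PLUQ.left, Matrix.submatrix_apply,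
      Equiv.symm_apply_apply, id] at this ⊢
    exact this
  · rw [left_submatrix]
    exact h.isUnit_det_L
  · rw [right_submatrix]
    exact h.upper.isUnit_det
  · intro s j
    simp
  · intro k hk
    rw [← h.eq_left_mul_right, h.rank_leading hk le_rfl]
    simp

/-- The transposed situation, with `U` and the pivot columns in the roles of `L` and the pivot rows.
-/
theorem rank_leading_below (her₁ : ∀ i, (er (Sum.inl i) : ℕ) = i)
    (her₂ : ∀ i, (er (Sum.inr i) : ℕ) = a + i) (hec : ∀ j, (ec (Sum.inl j) : ℕ) = j)
    (hm : m = a + d) (h : D.Reveals (A.submatrix er ec).toBlocks₁₁) {E : Matrix (Fin d) (Fin D.r) K}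
    {G : Matrix (Fin d) (Fin (b - D.r)) K}
    (hE : E = ((A.submatrix er ec).toBlocks₂₁.submatrix id D.Q).toCols₁ * D.U⁻¹)
    (hG : G = ((A.submatrix er ec).toBlocks₂₁.submatrix id D.Q).toCols₂ - E * D.V) {l : ℕ}
    (hl : l ≤ b) (k : ℕ) :
    (leading A (a + k) l).rank = (leading A a l).rank +
      (leading ((Matrix.fromCols 0 G).submatrix id D.Q.symm) k l).rank := by
  rw [← rank_leading_transpose A, ← rank_leading_transpose A,
    ← rank_leading_transpose ((Matrix.fromCols 0 G).submatrix id D.Q.symm)]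
  refine rank_leading_of_elimination (er := ec ∘ Sum.inl) (ec := er) (X := D.right.transpose)
    (Y := D.left.transpose) (D := E.transpose) (p := D.Q ∘ Sum.inl) (q := D.P ∘ Sum.inl)
    hec her₁ her₂ hm ?_ ?_ ?_ ?_ ?_ ?_ hl k
  · rw [← Matrix.transpose_mul, ← h.eq_left_mul_right]
    rfl
  · have hEU : E * D.U = ((A.submatrix er ec).toBlocks₂₁.submatrix id D.Q).toCols₁ := by
      rw [hE, Matrix.nonsing_inv_mul_cancel_right _ _ h.upper.isUnit_det]
    have hsub : (A.submatrix er ec).toBlocks₂₁.submatrix id D.Q =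
        E * Matrix.fromCols D.U D.V + Matrix.fromCols 0 G := by
      rw [Matrix.mul_fromCols, hEU, hG, ← Matrix.fromCols_toCols
        ((A.submatrix er ec).toBlocks₂₁.submatrix id D.Q)]
      ext i (j | j) <;> simp
    rw [← Matrix.transpose_mul, ← Matrix.transpose_add]
    ext j i
    obtain ⟨s, rfl⟩ := D.Q.surjective j
    have := congrFun (congrFun hsub i) s
    simp only [Matrix.transpose_apply, Matrix.add_apply, Matrix.mul_apply, PLUQ.right,
      Matrix.submatrix_apply, Equiv.symm_apply_apply, id] at this ⊢
    exact this
  · have := h.upper.isUnit_det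
    rw [← right_submatrix, ← Matrix.det_transpose] at this
    exact this
  · have := h.isUnit_det_L
    rw [← left_submatrix, ← Matrix.det_transpose] at this
    exact this
  · intro s j
    simp
  · intro l hl
    rw [← Matrix.transpose_mul, ← h.eq_left_mul_right, rank_leading_transpose,
      h.rank_leading le_rfl hl]
    simp

end PLUQ.Reveals

end Reveals

/-! ### Correctness and cost of LT-RPM -/

section Main

variable {K : Type u} [Field K]

theorem splitRows_inl_val (n : ℕ) (i : Fin (n - n / 2)) : (splitRows n (Sum.inl i) : ℕ) = i := rfl

theorem splitRows_inr_val (n : ℕ) (i : Fin (n / 2)) :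
    (splitRows n (Sum.inr i) : ℕ) = (n - n / 2) + i := rfl

theorem rank_leading_le_leftQSOrder {n : ℕ} (A : Matrix (Fin n) (Fin n) K) {k : ℕ} (hk : 1 ≤ k)
    (hk' : k ≤ n - 1) : (leading A k (n - k)).rank ≤ leftQSOrder A :=
  Finset.le_sup (f := fun k => (leading A k (n - k)).rank) (Finset.mem_Icc.2 ⟨hk, hk'⟩)

/-- The corner between the blocks lies on the antidiagonal because the row split `⌈n/2⌉` and the
column split `⌊n/2⌋` add up to `n`. So the first block is kept whole, the last is dropped, and the
other two are cut along their own antidiagonals. -/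
theorem leftPart_split_eq {n : ℕ} {R : Matrix (Fin n) (Fin n) K}
    {R₁ : Matrix (Fin (n - n / 2)) (Fin (n / 2)) ℕ}
    {R₂ : Matrix (Fin (n - n / 2)) (Fin (n - n / 2)) ℕ} {R₃ : Matrix (Fin (n / 2)) (Fin (n / 2)) ℕ}
    {T₂ : Matrix (Fin (n - n / 2)) (Fin (n - n / 2)) K} {T₃ : Matrix (Fin (n / 2)) (Fin (n / 2)) K}
    (h₁ : ∀ i j, R (splitRows n (Sum.inl i)) (splitCols n (Sum.inl j)) = R₁ i j)
    (h₂ : ∀ i j, R (splitRows n (Sum.inl i)) (splitCols n (Sum.inr j)) = T₂ i j)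
    (h₃ : ∀ i j, R (splitRows n (Sum.inr i)) (splitCols n (Sum.inl j)) = T₃ i j)
    (e₂ : R₂.map (Nat.cast : ℕ → K) = leftPart T₂) (e₃ : R₃.map (Nat.cast : ℕ → K) = leftPart T₃) :
    ((Matrix.fromBlocks R₁ R₂ R₃ 0).submatrix (splitRows n).symm (splitCols n).symm).map
      (Nat.cast : ℕ → K) = leftPart R := by
  ext i j
  obtain ⟨i, rfl⟩ := (splitRows n).surjective i
  obtain ⟨j, rfl⟩ := (splitCols n).surjective j
  simp only [Matrix.map_apply, Matrix.submatrix_apply, Equiv.symm_apply_apply, leftPart,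
    Matrix.of_apply]
  rcases i with i | i <;> rcases j with j | j
  · rw [if_pos (by rw [splitRows_inl_val, splitCols_inl_val]; omega), h₁]
    rfl
  · have := congrFun (congrFun e₂ i) j
    simp only [Matrix.map_apply, leftPart, Matrix.of_apply] at this
    rw [Matrix.fromBlocks_apply₁₂, this, h₂]
    refine if_congr ?_ rfl rfl
    rw [splitRows_inl_val, splitCols_inr_val]
    omega
  · have := congrFun (congrFun e₃ i) j
    simp only [Matrix.map_apply, leftPart, Matrix.of_apply] at this
    rw [Matrix.fromBlocks_apply₂₁, this, h₃]
    refine if_congr ?_ rfl rfl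
    rw [splitRows_inr_val, splitCols_inl_val]
    omega
  · rw [if_neg (by rw [splitRows_inr_val, splitCols_inr_val]; omega)]
    simp

/-- The five subroutine calls cost at most `C N² s ^ (ω - 2)` each, and the constant solves `x = 5 +
(5/8) x`, that is `x = 40/3`. -/
theorem step_cost_le {ω C : ℝ} (hω : 2 < ω) (hC : 0 ≤ C) {N r s : ℕ} (hN : 2 ≤ N)
    (hr₁ : r ≤ N - N / 2) (hr₂ : r ≤ N / 2) (hrs : r ≤ s) (hs : 1 ≤ s) {c₁ c₂ c₃ c₄ c₅ c₆ c₇ : ℝ}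
    (h₁ : c₁ ≤ C * (N - N / 2 : ℕ) * (N / 2 : ℕ) * ((max r 1 : ℕ) : ℝ) ^ (ω - 2))
    (h₂ : c₂ ≤ C * (max (N - N / 2) r : ℕ) * (r : ℝ) ^ (ω - 1))
    (h₃ : c₃ ≤ C * (max (N / 2) r : ℕ) * (r : ℝ) ^ (ω - 1))
    (h₄ : c₄ ≤ C * (max (N - N / 2 - r) r : ℕ) * (max (N - N / 2) r : ℕ) *
      ((max r 1 : ℕ) : ℝ) ^ (ω - 2))
    (h₅ : c₅ ≤ C * (max (N / 2) r : ℕ) * (max (N / 2 - r) r : ℕ) *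
      ((max r 1 : ℕ) : ℝ) ^ (ω - 2))
    (h₆ : c₆ ≤ 40 / 3 * C * ((N - N / 2 : ℕ) : ℝ) ^ 2 * (s : ℝ) ^ (ω - 2))
    (h₇ : c₇ ≤ 40 / 3 * C * ((N / 2 : ℕ) : ℝ) ^ 2 * (s : ℝ) ^ (ω - 2)) :
    c₁ + c₂ + c₃ + c₄ + c₅ + c₆ + c₇ ≤ 40 / 3 * C * (N : ℝ) ^ 2 * (s : ℝ) ^ (ω - 2) := by
  have hcast : ∀ {x : ℕ}, x ≤ N → (x : ℝ) ≤ N := fun h => by exact_mod_cast h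
  have k1 : ((N - N / 2 : ℕ) : ℝ) ≤ N := hcast (by omega)
  have k2 : ((N / 2 : ℕ) : ℝ) ≤ N := hcast (by omega)
  have k3 : ((max (N - N / 2) r : ℕ) : ℝ) ≤ N := hcast (by omega)
  have k4 : ((max (N / 2) r : ℕ) : ℝ) ≤ N := hcast (by omega)
  have k5 : ((max (N - N / 2 - r) r : ℕ) : ℝ) ≤ N := hcast (by omega)
  have k6 : ((max (N / 2 - r) r : ℕ) : ℝ) ≤ N := hcast (by omega)
  have k7 : (r : ℝ) ≤ N := hcast (by omega)
  have w1 : ((max r 1 : ℕ) : ℝ) ^ (ω - 2) ≤ (s : ℝ) ^ (ω - 2) :=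
    Real.rpow_le_rpow (by positivity) (by exact_mod_cast max_le hrs hs) (by linarith)
  have w2 : (r : ℝ) ^ (ω - 2) ≤ (s : ℝ) ^ (ω - 2) :=
    Real.rpow_le_rpow (by positivity) (by exact_mod_cast hrs) (by linarith)
  rw [rpow_sub_one_eq hω] at h₂ h₃
  set w := (s : ℝ) ^ (ω - 2)
  have hw : 0 ≤ w := by positivity
  have i₁ : c₁ ≤ C * N * N * w := h₁.trans (by gcongr)
  have i₂ : c₂ ≤ C * N * (N * w) := h₂.trans (by gcongr)
  have i₃ : c₃ ≤ C * N * (N * w) := h₃.trans (by gcongr)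
  have i₄ : c₄ ≤ C * N * N * w := h₄.trans (by gcongr)
  have i₅ : c₅ ≤ C * N * N * w := h₅.trans (by gcongr)
  -- The halves differ by at most one, so the sum of squares is at most `(N² + 1) / 2`, and `N ≥ 2`
  -- bounds this by `5/8 N²`.
  have hsq : ((N - N / 2 : ℕ) : ℝ) ^ 2 + ((N / 2 : ℕ) : ℝ) ^ 2 ≤ 5 / 8 * (N : ℝ) ^ 2 := by
    have hsum : ((N - N / 2 : ℕ) : ℝ) + ((N / 2 : ℕ) : ℝ) = N := by
      exact_mod_cast (by omega : N - N / 2 + N / 2 = N)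
    have hle : ((N / 2 : ℕ) : ℝ) ≤ ((N - N / 2 : ℕ) : ℝ) := by exact_mod_cast (by omega)
    have hge : ((N - N / 2 : ℕ) : ℝ) ≤ ((N / 2 : ℕ) : ℝ) + 1 := by exact_mod_cast (by omega)
    have hN' : (2 : ℝ) ≤ N := by exact_mod_cast hN
    rw [← hsum] at hN' ⊢
    nlinarith
  have hCw : 0 ≤ C * w := by positivity
  have := mul_le_mul_of_nonneg_left hsq hCw
  linarith

theorem Subroutines.CostBound.mono {S : Subroutines K} {ω C C' : ℝ} (h : S.CostBound ω C)
    (hC : C ≤ C') : S.CostBound ω C' where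
  pluq m n A μ hA := (h.pluq m n A μ hA).trans (by gcongr)
  solveLower r n L B μ hL hB hL' := (h.solveLower r n L B μ hL hB hL').trans (by gcongr)
  solveUpper m r X U μ hX hU hU' := (h.solveUpper m r X U μ hX hU hU').trans (by gcongr)
  mulSub m k n B X Y μ hB hX hY := (h.mulSub m k n B X Y μ hB hX hY).trans (by gcongr)

theorem Subroutines.Correct.exists_isRankProfileMatrix {S : Subroutines K} (hS : S.Correct)
    {m n : ℕ} {A : AMat m n} {μ : List K} (hA : A.Valid μ) :
    ∃ R, IsRankProfileMatrix (A.val μ) R := ⟨_, (hS.pluq m n A μ hA).2.rpm⟩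

theorem ltRPM_of_two_le (S : Subroutines K) {n : ℕ} (hn : 2 ≤ n) (A : AMat n n) :
    ltRPM S n A = (do
      let A' := A.submatrix (splitRows n) (splitCols n)
      let D ← S.pluq _ _ A'.toBlocks₁₁
      let X ← S.solveLower _ _ D.L (A'.toBlocks₁₂.submatrix D.P id).toRows₁
      let E ← S.solveUpper _ _ (A'.toBlocks₂₁.submatrix id D.Q).toCols₁ D.U
      let F ← S.mulSub _ _ _ (A'.toBlocks₁₂.submatrix D.P id).toRows₂ D.M X
      let G ← S.mulSub _ _ _ (A'.toBlocks₂₁.submatrix id D.Q).toCols₂ E D.V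
      let z ← Prog.const 0 pure
      let H := (Matrix.fromRows (Matrix.of fun _ _ => z) F).submatrix D.P.symm id
      let I := (Matrix.fromCols (Matrix.of fun _ _ => z) G).submatrix id D.Q.symm
      let R₂ ← ltRPM S (n - n / 2) H
      let R₃ ← ltRPM S (n / 2) I
      pure ((Matrix.fromBlocks D.pivots R₂ R₃ 0).submatrix (splitRows n).symm
        (splitCols n).symm)) := by
  obtain ⟨m, rfl⟩ := Nat.exists_eq_add_of_le' hn
  rw [ltRPM]

/-- The induction runs with a fixed bound `s` on the order, because the orders of `H` and `I` may be
smaller than that of `A`. The cost is a conditional clause so that correctness does not depend on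
the costs of the subroutines. -/
theorem ltRPM_spec {S : Subroutines K} (hS : S.Correct) {ω C : ℝ} (hω : 2 < ω) (hC : 0 ≤ C)
    (n : ℕ) (A : AMat n n) (μ : List K) (hA : A.Valid μ) (R : Matrix (Fin n) (Fin n) K)
    (hR : IsRankProfileMatrix (A.val μ) R) (s : ℕ) (hs : 1 ≤ s) (hAs : leftQSOrder (A.val μ) ≤ s) :
    (ltRPM S n A).Spec μ fun T _ c => T.map (Nat.cast : ℕ → K) = leftPart R ∧
      (S.CostBound ω C → (c : ℝ) ≤ 40 / 3 * C * (n : ℝ) ^ 2 * (s : ℝ) ^ (ω - 2)) := by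
  induction n using Nat.strong_induction_on generalizing μ with
  | _ N ih =>
  rcases lt_or_ge N 2 with hN | hN
  · have h0 : (ltRPM S N A) = pure 0 := by
      interval_cases N <;> rw [ltRPM]
    rw [h0]
    refine Prog.Spec.pure ⟨?_, fun _ => ?_⟩
    · ext i j
      rw [leftPart, Matrix.of_apply, if_neg (by omega)]
      simp
    · rw [Nat.cast_zero]
      positivity
  rw [ltRPM_of_two_le S hN]
  set A' := A.submatrix (splitRows N) (splitCols N)
  have v₁ : AMat.Valid A'.toBlocks₁₁ μ := fun i j => hA _ _
  have v₂ : AMat.Valid A'.toBlocks₁₂ μ := fun i j => hA _ _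
  have v₃ : AMat.Valid A'.toBlocks₂₁ μ := fun i j => hA _ _
  refine Prog.Spec.bind (Q₁ := fun D ν c => D.Valid ν ∧ (D.val ν).Reveals (AMat.val A'.toBlocks₁₁ μ)
    ∧ (S.CostBound ω C → (c : ℝ) ≤ C * (N - N / 2 : ℕ) * (N / 2 : ℕ) *
      ((max (AMat.val A'.toBlocks₁₁ μ).rank 1 : ℕ) : ℝ) ^ (ω - 2)))
    ⟨(hS.pluq _ _ _ μ v₁).1, (hS.pluq _ _ _ μ v₁).2, fun h => h.pluq _ _ _ μ v₁⟩ ?_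
  rintro D ν₁ c₁ h₁ ⟨⟨vL, vM, vU, vV⟩, hD, hc₁⟩
  have vB₁ : AMat.Valid (A'.toBlocks₁₂.submatrix D.P id).toRows₁ μ := fun i j => hA _ _
  have vB₂ : AMat.Valid (A'.toBlocks₁₂.submatrix D.P id).toRows₂ μ := fun i j => hA _ _
  have vC₁ : AMat.Valid (A'.toBlocks₂₁.submatrix id D.Q).toCols₁ μ := fun i j => hA _ _
  have vC₂ : AMat.Valid (A'.toBlocks₂₁.submatrix id D.Q).toCols₂ μ := fun i j => hA _ _
  have hr : (AMat.val A'.toBlocks₁₁ μ).rank = D.r := hD.rank_eq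
  rw [hr] at hc₁
  have sL := hS.solveLower _ _ D.L _ ν₁ vL (vB₁.mono h₁) hD.lower
  refine Prog.Spec.bind (Q₁ := fun X ν c => AMat.Valid X ν ∧
    AMat.val X ν = (AMat.val D.L ν₁)⁻¹ * AMat.val (A'.toBlocks₁₂.submatrix D.P id).toRows₁ ν₁ ∧
    (S.CostBound ω C → (c : ℝ) ≤ C * (max (N - N / 2) D.r : ℕ) * (D.r : ℝ) ^ (ω - 1)))
    ⟨sL.1, sL.2, fun h => h.solveLower _ _ D.L _ ν₁ vL (vB₁.mono h₁) hD.lower⟩ ?_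
  rintro X ν₂ c₂ h₂ ⟨vX, hX, hc₂⟩
  have h02 := h₁.trans h₂
  have hU : IsNonsingUpper (AMat.val D.U ν₂) := by
    rw [AMat.Valid.val_eq vU h₂]
    exact hD.upper
  have sU := hS.solveUpper _ _ _ D.U ν₂ (vC₁.mono h02) (AMat.Valid.mono vU h₂) hU
  refine Prog.Spec.bind (Q₁ := fun E ν c => AMat.Valid E ν ∧
    AMat.val E ν = AMat.val (A'.toBlocks₂₁.submatrix id D.Q).toCols₁ ν₂ * (AMat.val D.U ν₂)⁻¹ ∧
    (S.CostBound ω C → (c : ℝ) ≤ C * (max (N / 2) D.r : ℕ) * (D.r : ℝ) ^ (ω - 1)))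
    ⟨sU.1, sU.2, fun h => h.solveUpper _ _ _ D.U ν₂ (vC₁.mono h02) (AMat.Valid.mono vU h₂) hU⟩ ?_
  rintro E ν₃ c₃ h₃ ⟨vE, hE, hc₃⟩
  have h03 := h02.trans h₃
  have h13 := h₂.trans h₃
  have sF := hS.mulSub _ _ _ _ D.M X ν₃ (vB₂.mono h03) (AMat.Valid.mono vM h13) (vX.mono h₃)
  refine Prog.Spec.bind (Q₁ := fun F ν c => AMat.Valid F ν ∧
    AMat.val F ν = AMat.val (A'.toBlocks₁₂.submatrix D.P id).toRows₂ ν₃ -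
      AMat.val D.M ν₃ * AMat.val X ν₃ ∧
    (S.CostBound ω C → (c : ℝ) ≤ C * (max (N - N / 2 - D.r) D.r : ℕ) *
      (max (N - N / 2) D.r : ℕ) * ((max D.r 1 : ℕ) : ℝ) ^ (ω - 2)))
    ⟨sF.1, sF.2, fun h => h.mulSub _ _ _ _ D.M X ν₃ (vB₂.mono h03) (AMat.Valid.mono vM h13)
      (vX.mono h₃)⟩ ?_
  rintro F ν₄ c₄ h₄ ⟨vF, hF, hc₄⟩
  have h04 := h03.trans h₄
  have h14 := h13.trans h₄
  have sG := hS.mulSub _ _ _ _ E D.V ν₄ (vC₂.mono h04) (vE.mono h₄) (AMat.Valid.mono vV h14)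
  refine Prog.Spec.bind (Q₁ := fun G ν c => AMat.Valid G ν ∧
    AMat.val G ν = AMat.val (A'.toBlocks₂₁.submatrix id D.Q).toCols₂ ν₄ -
      AMat.val E ν₄ * AMat.val D.V ν₄ ∧
    (S.CostBound ω C → (c : ℝ) ≤ C * (max (N / 2) D.r : ℕ) *
      (max (N / 2 - D.r) D.r : ℕ) * ((max D.r 1 : ℕ) : ℝ) ^ (ω - 2)))
    ⟨sG.1, sG.2, fun h => h.mulSub _ _ _ _ E D.V ν₄ (vC₂.mono h04) (vE.mono h₄)
      (AMat.Valid.mono vV h14)⟩ ?_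
  rintro G ν₅ c₅ h₅ ⟨vG, hG, hc₅⟩
  refine (Prog.Spec.const 0 ν₅).bind ?_
  rintro z ν₆ _ h₆ ⟨vz, hz, rfl⟩
  rw [AMat.Valid.val_eq vB₁ h₁] at hX
  rw [AMat.Valid.val_eq vC₁ h02, AMat.Valid.val_eq vU h₂] at hE
  rw [AMat.Valid.val_eq vB₂ h03, AMat.Valid.val_eq vM h13, AMat.Valid.val_eq vX h₃] at hF
  rw [AMat.Valid.val_eq vC₂ h04, AMat.Valid.val_eq vE h₄, AMat.Valid.val_eq vV h14] at hG
  set H : AMat (N - N / 2) (N - N / 2) :=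
    (Matrix.fromRows (Matrix.of fun _ _ => z) F).submatrix D.P.symm id with hHdef
  set I : AMat (N / 2) (N / 2) :=
    (Matrix.fromCols (Matrix.of fun _ _ => z) G).submatrix id D.Q.symm with hIdef
  have vH : H.Valid ν₆ := by
    intro i j
    obtain ⟨i, rfl⟩ := D.P.surjective i
    rw [hHdef, Matrix.submatrix_apply, Equiv.symm_apply_apply]
    rcases i with i | i
    exacts [vz, vF.mono (h₅.trans h₆) _ _]
  have vI : I.Valid ν₆ := by
    intro i j
    obtain ⟨j, rfl⟩ := D.Q.surjective j
    rw [hIdef, Matrix.submatrix_apply, Equiv.symm_apply_apply]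
    rcases j with j | j
    exacts [vz, vG.mono h₆ _ _]
  have hH : H.val ν₆ = (Matrix.fromRows 0 (F.val ν₄)).submatrix D.P.symm id := by
    rw [← AMat.Valid.val_eq vF (h₅.trans h₆)]
    ext i j
    obtain ⟨i, rfl⟩ := D.P.surjective i
    rw [hHdef, AMat.val, Matrix.of_apply, Matrix.submatrix_apply, Matrix.submatrix_apply,
      Equiv.symm_apply_apply]
    rcases i with i | i
    exacts [hz, rfl]
  have hI : I.val ν₆ = (Matrix.fromCols 0 (G.val ν₅)).submatrix id D.Q.symm := by
    rw [← AMat.Valid.val_eq vG h₆]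
    ext i j
    obtain ⟨j, rfl⟩ := D.Q.surjective j
    rw [hIdef, AMat.val, Matrix.of_apply, Matrix.submatrix_apply, Matrix.submatrix_apply,
      Equiv.symm_apply_apply]
    rcases j with j | j
    exacts [hz, rfl]
  have rkH : ∀ {k : ℕ}, k ≤ N - N / 2 → ∀ l, (leading (A.val μ) k (N / 2 + l)).rank =
      (leading (A.val μ) k (N / 2)).rank + (leading (H.val ν₆) k l).rank := by
    intro k hk l
    rw [hH]
    exact PLUQ.Reveals.rank_leading_right (A := A.val μ) (er := splitRows N) (ec := splitCols N)
      (splitRows_inl_val N) (splitCols_inl_val N) (splitCols_inr_val N) (by omega) hD hX hF hk l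
  have rkI : ∀ {l : ℕ}, l ≤ N / 2 → ∀ k, (leading (A.val μ) (N - N / 2 + k) l).rank =
      (leading (A.val μ) (N - N / 2) l).rank + (leading (I.val ν₆) k l).rank := by
    intro l hl k
    rw [hI]
    exact PLUQ.Reveals.rank_leading_below (A := A.val μ) (er := splitRows N) (ec := splitCols N)
      (splitRows_inl_val N) (splitRows_inr_val N) (splitCols_inl_val N) (by omega) hD hE hG hl k
  have rk₁ : ∀ {k l : ℕ}, k ≤ N - N / 2 → l ≤ N / 2 →
      (leading (AMat.val A'.toBlocks₁₁ μ) k l).rank = (leading (A.val μ) k l).rank :=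
    fun hk hl => rank_leading_submatrix (A.val μ) (splitRows_inl_val N) (splitCols_inl_val N) hk hl
  obtain ⟨RH, hRH⟩ := hS.exists_isRankProfileMatrix vH
  obtain ⟨RI, hRI⟩ := hS.exists_isRankProfileMatrix vI
  -- By the rank identity, a `k × (⌈N/2⌉ - k)` leading rank of `H` is bounded by the `k × (N - k)`
  -- leading rank of `A`, again one of those defining the order.
  have ordH : leftQSOrder (H.val ν₆) ≤ s := by
    refine Finset.sup_le fun k hk => le_trans ?_ hAs
    obtain ⟨hk1, hk2⟩ := Finset.mem_Icc.1 hk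
    have e := rkH (k := k) (by omega) (N - N / 2 - k)
    rw [show N / 2 + (N - N / 2 - k) = N - k by omega] at e
    have := rank_leading_le_leftQSOrder (A.val μ) (k := k) hk1 (by omega)
    omega
  -- Likewise with `⌈N/2⌉ + k` rows and `⌊N/2⌋ - k` columns of `A`.
  have ordI : leftQSOrder (I.val ν₆) ≤ s := by
    refine Finset.sup_le fun k hk => le_trans ?_ hAs
    obtain ⟨hk1, hk2⟩ := Finset.mem_Icc.1 hk
    have e := rkI (l := N / 2 - k) (by omega) k
    have := rank_leading_le_leftQSOrder (A.val μ) (k := N - N / 2 + k) (by omega) (by omega)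
    rw [show N - (N - N / 2 + k) = N / 2 - k by omega] at this
    omega
  -- `A₁` is itself one of the submatrices defining the order, with `⌈N/2⌉` rows.
  have hrs : D.r ≤ s := by
    rw [← hr, ← rank_leading_self, rk₁ le_rfl le_rfl]
    have := rank_leading_le_leftQSOrder (A.val μ) (k := N - N / 2) (by omega) (by omega)
    rw [show N - (N - N / 2) = N / 2 by omega] at this
    exact this.trans hAs
  have hr₁ : D.r ≤ N - N / 2 := by
    rw [← hr]
    exact Matrix.rank_le_height _
  have hr₂ : D.r ≤ N / 2 := by
    rw [← hr]
    exact Matrix.rank_le_width _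
  refine (ih (N - N / 2) (by omega) H ν₆ vH RH hRH ordH).bind ?_
  rintro R₂ ν₇ c₆ h₇ ⟨hR₂, hc₆⟩
  rw [← AMat.Valid.val_eq vI h₇] at hRI ordI
  refine (ih (N / 2) (by omega) I ν₇ (vI.mono h₇) RI hRI ordI).bind ?_
  rintro R₃ ν₈ c₇ h₈ ⟨hR₃, hc₇⟩
  rw [AMat.Valid.val_eq vI h₇] at hRI
  refine Prog.Spec.pure ⟨?_, fun h => ?_⟩
  · refine leftPart_split_eq (R₁ := D.pivots) (T₂ := RH) (T₃ := RI) ?_ ?_ ?_ hR₂ hR₃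
    · intro i j
      have hi := i.2
      have hj := j.2
      refine hR.entry_eq hD.rpm (i' := i) (j' := j) (c₁ := 0) (c₂ := 0) (c₃ := 0) (c₄ := 0) rfl
        ?_ ?_ ?_ ?_
      all_goals
        rw [zero_add, rk₁ (by omega) (by omega)]
        rfl
    · intro i j
      -- The corrections are ranks of leading submatrices of fixed width `⌊N/2⌋`; they do not depend
      -- on `j` and cancel in pairs.
      exact hR.entry_eq hRH rfl (rkH i.2 (j + 1)) (rkH i.2.le j) (rkH i.2 j) (rkH i.2.le (j + 1))
    · intro i j
      exact hR.entry_eq hRI (add_comm _ _) (rkI j.2 (i + 1)) (rkI j.2.le i) (rkI j.2.le (i + 1))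
        (rkI j.2 i)
  · have := step_cost_le hω hC hN hr₁ hr₂ hrs hs (hc₁ h) (hc₂ h) (hc₃ h) (hc₄ h) (hc₅ h) (hc₆ h)
      (hc₇ h)
    push_cast
    linarith

end Main

end LTRPM

/-! ### The main theorem. -/

theorem mainTheorem1 {K : Type u} [Field K] (ω : ℝ) (hω : 2 < ω)
    (hmm : LTRPM.MatMulExponent K ω) :
    (∃ (S : LTRPM.Subroutines K) (C : ℝ), S.Correct ∧ S.CostBound ω C) ∧
    (∀ S : LTRPM.Subroutines K, S.Correct →
      ∀ (n : ℕ) (A : LTRPM.AMat n n) (μ : List K), A.Valid μ →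
        ∃ R : Matrix (Fin n) (Fin n) K,
          LTRPM.IsRankProfileMatrix (A.val μ) R ∧
          (∀ R', LTRPM.IsRankProfileMatrix (A.val μ) R' → R' = R) ∧
          ((LTRPM.ltRPM S n A).run μ).result.map (Nat.cast : ℕ → K) = LTRPM.leftPart R) ∧
    (∀ C : ℝ, ∃ C' : ℝ, ∀ S : LTRPM.Subroutines K, S.Correct → S.CostBound ω C →
      ∀ (n : ℕ) (A : LTRPM.AMat n n) (μ : List K), A.Valid μ →
        (((LTRPM.ltRPM S n A).run μ).cost : ℝ)
          ≤ C' * (n : ℝ) ^ 2 * ((max (LTRPM.leftQSOrder (A.val μ)) 1 : ℕ) : ℝ) ^ (ω - 2)) := by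
  -- The given constant `C` may be negative, so it is replaced by `max C 0`.
  refine ⟨LTRPM.exists_fast_subroutines hω hmm, ?_, fun C => ⟨40 / 3 * max C 0, ?_⟩⟩
  · intro S hS n A μ hA
    obtain ⟨R, hR⟩ := hS.exists_isRankProfileMatrix hA
    -- Only the correctness clause is used here, so the cost constant is taken to be `0`.
    exact ⟨R, hR, fun R' hR' => hR'.unique hR, (LTRPM.ltRPM_spec hS hω le_rfl n A μ hA R hR _
      (le_max_right _ 1) (le_max_left _ _)).1⟩
  · intro S hS hSC n A μ hA
    obtain ⟨R, hR⟩ := hS.exists_isRankProfileMatrix hA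
    exact (LTRPM.ltRPM_spec hS hω (le_max_right C 0) n A μ hA R hR _ (le_max_right _ 1)
      (le_max_left _ _)).2 (hSC.mono (le_max_left _ _))
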